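/- Setting. Let $f_g,f_r$ be probability densities (or mass functions) on $[0,1]$ with respect to a common $\sigma$-finite measure $\nu$ (e.g. Lebesgue measure, or counting measure on a countable set), and let $\mathcal H(f_g,f_r)=\big(\tfrac12\int(\sqrt{f_g}-\sqrt{f_r})^2\,d\nu\big)^{1/2}$ be their Hellinger divergence. The set $[n]$ is partitioned into $k$ nonempty unknown clusters, where $2\le k\le n-1$. One is given a symmetric similarity matrix whose entries $w_{u,v}$, $u<v$, are independent, with density $f_g$ if $u,v$ lie in the same cluster and $f_r$ otherwise. A (possibly randomized, adaptive) algorithm, which may depend on $n,k,\nu,f_g,f_r$, sees the matrix, successively queries pairs $(u,v)$ to an oracle that truthfully says whether $u$ and $v$ lie in the same cluster, and may at some point stop and output a clustering. It is *exact* if for every clustering of $[n]$ into $k$ clusters it outputs that clustering with probability $1$ (over the matrix and its own coins). Statement. Any exact algorithm must perform $\Omega\big(n+\min\{k^2/\mathcal H^2(f_g,f_r),\,nk\}\big)$ queries; in particular $\Omega\big(n+k^2/\mathcal H^2(f_g,f_r)\big)$ queries when $n\ge k/\mathcal H^2(f_g,f_r)$. Precisely: 1. There is a universal constant $c>0$ such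 that, whenever $0<\mathcal H(f_g,f_r)<1$, for every exact algorithm there is a clustering into $k$ clusters on which, with positive probability, it makes at least $c\,\big(n+\min\{k^2/\mathcal H^2(f_g,f_r),nk\}\big)$ queries. 2. For every $\eta<1$ there is a constant $c_\eta>0$, depending only on $\eta$, such that, whenever the two distributions are mutually absolutely continuous and $0<\mathcal H(f_g,f_r)\le\eta$, for every exact algorithm there is a clustering into $k$ clusters on which the expected number of its queries is at least $c_\eta\,\big(n+\min\{k^2/\mathcal H^2(f_g,f_r),nk\}\big)$. -/

import Mathlib

open MeasureTheory
open scoped ENNReal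

universe u

/-- `f` is a probability density with respect to the reference measure `ν`, supported in `[0,1]`.
Lebesgue measure as `ν` gives probability density functions, and counting measure on a countable
set gives probability mass functions. -/
structure IsDensity (ν : Measure ℝ) (f : ℝ → ℝ) : Prop where
  measurable : Measurable f
  nonneg : ∀ x, 0 ≤ f x
  support : ∀ x, x ∉ Set.Icc (0 : ℝ) 1 → f x = 0
  lintegral_eq_one : ∫⁻ x, ENNReal.ofReal (f x) ∂ν = 1

/-- The probability distribution on `ℝ` with density `f` with respect to `ν`. -/
noncomputable def densityLaw (ν : Measure ℝ) (f : ℝ → ℝ) : Measure ℝ :=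
  ν.withDensity fun x => ENNReal.ofReal (f x)

/-- The Hellinger divergence `√(½ ∫ (√f - √g)² dν)`. -/
noncomputable def hellinger (ν : Measure ℝ) (f g : ℝ → ℝ) : ℝ :=
  Real.sqrt ((1 / 2) * ∫ x, (Real.sqrt (f x) - Real.sqrt (g x)) ^ 2 ∂ν)

/-- A clustering of the `n` elements: a partition into nonempty clusters. -/
abbrev Clustering (n : ℕ) : Type := Finpartition (Finset.univ : Finset (Fin n))

/-- `u` and `v` belong to the same cluster of `P`. -/
abbrev Clustering.Same {n : ℕ} (P : Clustering n) (u v : Fin n) : Prop := P.part u = P.part v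

/-- Unordered pairs of distinct elements, listed as `u < v`. -/
abbrev Pair (n : ℕ) : Type := {p : Fin n × Fin n // p.1 < p.2}

/-- The similarity values; the matrix is symmetric, so one entry for each unordered pair. -/
abbrev Similarity (n : ℕ) : Type := Pair n → ℝ

/-- The law of the similarity matrix when the clustering is `P`: independent entries, with
density `fg` inside the clusters and `fr` across them. -/
noncomputable def similarityLaw {n : ℕ} (ν : Measure ℝ) (fg fr : ℝ → ℝ) (P : Clustering n) :
    Measure (Similarity n) :=
  Measure.pi fun p => if P.Same p.1.1 p.1.2 then densityLaw ν fg else densityLaw ν fr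

/-- A randomized adaptive algorithm. It draws a random seed, independent of everything else, and
reads the similarity matrix. From these and the list of the answers so far it decides either to
ask the oracle about a further pair or to stop and return a clustering. -/
structure RandAlg (n : ℕ) where
  Seed : Type u
  [seedSpace : MeasurableSpace Seed]
  seedLaw : Measure Seed
  [seedProb : IsProbabilityMeasure seedLaw]
  step : Seed → Similarity n → List Bool → (Fin n × Fin n) ⊕ Clustering n
  measurable_step : ∀ (h : List Bool) (a : (Fin n × Fin n) ⊕ Clustering n),
    MeasurableSet {x : Seed × Similarity n | step x.1 x.2 h = a}

attribute [instance] RandAlg.seedSpace RandAlg.seedProb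

namespace RandAlg

variable {n : ℕ} (A : RandAlg.{u} n)

/-- The answers of the perfect oracle received within the first `t` steps, if the clustering is
`P`, in the order of the queries. The list stays constant once the algorithm has stopped. -/
def answers (P : Clustering n) (x : A.Seed × Similarity n) : ℕ → List Bool
  | 0 => []
  | t + 1 =>
    match A.step x.1 x.2 (answers P x t) with
    | Sum.inl q => answers P x t ++ [decide (P.Same q.1 q.2)]
    | Sum.inr _ => answers P x t

/-- The total number of queries made (infinite if the algorithm never stops). -/
noncomputable def numQueries (P : Clustering n) (x : A.Seed × Similarity n) : ℕ∞ :=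
  ⨆ t : ℕ, ((A.answers P x t).length : ℕ∞)

/-- The algorithm stops and returns `Q`, while the clustering is `P`. -/
def Returns (P : Clustering n) (x : A.Seed × Similarity n) (Q : Clustering n) : Prop :=
  ∃ t : ℕ, A.step x.1 x.2 (A.answers P x t) = Sum.inr Q

/-- The joint law of the seed and the similarity matrix, if the clustering is `P`. -/
noncomputable def law (ν : Measure ℝ) (fg fr : ℝ → ℝ) (P : Clustering n) :
    Measure (A.Seed × Similarity n) :=
  A.seedLaw.prod (similarityLaw ν fg fr P)

/-- For every clustering into exactly `k` clusters, the algorithm returns it with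
probability `1`. -/
def IsExact (ν : Measure ℝ) (fg fr : ℝ → ℝ) (k : ℕ) : Prop :=
  ∀ P : Clustering n, P.parts.card = k → ∀ᵐ x ∂(A.law ν fg fr P), A.Returns P x P

end RandAlg

/-- The quantity `n + min {k² / H², n k}`. -/
noncomputable def queryBound (n k : ℕ) (H : ℝ) : ℝ :=
  (n : ℝ) + min ((k : ℝ) ^ 2 / H ^ 2) ((n : ℝ) * (k : ℝ))

/-!
An exact algorithm errs with probability `0`, so, for almost every seed and matrix that is possible
under several clusterings, it has to be correct for all of these clusterings at once. For such a
fixed seed and matrix it is a deterministic decision procedure, and the similarities can only bias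
the choice of its queries. This gives both parts from one statement on experiments
(`IsExperiment`): a family of laws `Q P` of seed and matrix, under each of which the algorithm is
almost surely correct for every clustering into `k` clusters, and whose total variation distances
are controlled by a number `h` as for products of laws with Hellinger divergence `h`.

* Under mutual absolute continuity the laws of the problem are such a family, with `h` the
  Hellinger divergence (`RandAlg.IsExact.isExperiment`). The total variation bound comes from the
  multiplicativity of the affinity `∫ √(f g) = 1 - H²` (`similarityLaw_le_add`).
* Without it, a matrix all of whose entries lie in the common support of the densities has positive
  probability. The point mass at such a matrix, the same for all clusterings, is an experiment with
  `h = 0`, and then `n + n k` queries are needed up to a constant; some clustering occurs for a set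
  of matrices of positive measure (`RandAlg.IsExact.exists_pos_law`).

The lower bound for experiments rests on `RandAlg.card_queryCount_lt_le`. Let clusterings `P i`
differ from a reference clustering `P₀` only in disjoint sets `D i` of pairs. The run on `P i`
follows the run on `P₀` until the latter first meets `D i`; so the number of queries on `P i` is at
least the rank of `D i` in the run on `P₀`, and few `i` have a small rank. If the laws of the `P i`
are close to that of `P₀`, this persists on average over `i`
(`IsExperiment.le_sum_lintegral_queryCount`). It is used in two ways:

* to find one hidden pair among about `k²` candidates, each of which changes the law of a single
  matrix entry (`IsExperiment.exists_sq_le`, of order `k²`);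
* to find the cluster of each of `N` elements that are thrown independently into `k - 1` clusters
  of average size at most of order `1 / h²`. By Bernoulli's inequality the entries that belong to
  one element and one cluster have affinity close to `1` (`IsExperiment.exists_mul_le`, of order
  `N k`, where `N` is of the order of the minimum of `n` and `k / h²`).

As each element of a cluster with several elements must be queried, order `n - k` is needed as well
(`IsExperiment.exists_half_sub_le`). The three bounds together give the theorem.
-/

/-! ### Runs of an algorithm on different clusterings -/

namespace RandAlg

variable {n : ℕ} (A : RandAlg.{u} n)

/-- On the clustering `P`, the algorithm queries at time `t` a pair from the set `U`. -/
def Asks (P : Clustering n) (U : Set (Fin n × Fin n)) (x : A.Seed × Similarity n) (t : ℕ) : Prop :=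
  ∃ q ∈ U, A.step x.1 x.2 (A.answers P x t) = Sum.inl q

open Classical in
/-- The number of queries of pairs from `U` made on the clustering `P`, with repetitions. -/
noncomputable def queryCount (U : Set (Fin n × Fin n)) (P : Clustering n)
    (x : A.Seed × Similarity n) : ℝ≥0∞ :=
  ∑' t : ℕ, if A.Asks P U x t then 1 else 0

variable {A} {P P' Q Q' : Clustering n} {x : A.Seed × Similarity n}
  {U D : Set (Fin n × Fin n)}

theorem answers_congr (hD : ∀ q, q ∉ D → (P'.Same q.1 q.2 ↔ P.Same q.1 q.2)) {T : ℕ}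
    (h : ∀ t < T, ¬ A.Asks P D x t) : A.answers P' x T = A.answers P x T := by
  induction T with
  | zero => rfl
  | succ T ih =>
    have e := ih fun t ht => h t (by omega)
    have hT := h T (by omega)
    simp only [answers, e]
    cases hs : A.step x.1 x.2 (A.answers P x T) with
    | inr R => rfl
    | inl q =>
      have hq : q ∉ D := fun hq => hT ⟨q, hq, hs⟩
      simp only [hD q hq]

theorem answers_eq_of_stopped {t t' : ℕ} (h : A.step x.1 x.2 (A.answers P x t) = Sum.inr Q)
    (htt' : t ≤ t') : A.answers P x t' = A.answers P x t := by
  induction t', htt' using Nat.le_induction with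
  | base => rfl
  | succ m hm ih => simp [answers, ih, h]

theorem Returns.unique (h : A.Returns P x Q) (h' : A.Returns P x Q') : Q = Q' := by
  obtain ⟨t, ht⟩ := h
  obtain ⟨t', ht'⟩ := h'
  rcases le_total t t' with hle | hle
  · rw [answers_eq_of_stopped ht hle, ht] at ht'
    exact Sum.inr_injective ht'
  · rw [answers_eq_of_stopped ht' hle, ht'] at ht
    exact (Sum.inr_injective ht).symm

theorem Returns.congr (hD : ∀ q, q ∉ D → (P'.Same q.1 q.2 ↔ P.Same q.1 q.2))
    (h : ∀ t, ¬ A.Asks P D x t) (hr : A.Returns P' x Q) : A.Returns P x Q := by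
  obtain ⟨t, ht⟩ := hr
  exact ⟨t, by rwa [answers_congr hD fun s _ => h s] at ht⟩

theorem Asks.mono (h : D ⊆ U) {t : ℕ} (ha : A.Asks P D x t) : A.Asks P U x t := by
  obtain ⟨q, hq, e⟩ := ha
  exact ⟨q, h hq, e⟩

open Classical in
theorem count_le_queryCount (t : ℕ) : (Nat.count (A.Asks P U x) t : ℝ≥0∞) ≤ A.queryCount U P x := by
  rw [Nat.count_eq_card_filter_range, Finset.card_filter]
  push_cast
  exact ENNReal.sum_le_tsum _

open Classical in
theorem one_le_queryCount {t : ℕ} (h : A.Asks P U x t) : 1 ≤ A.queryCount U P x := by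
  have := ENNReal.le_tsum (f := fun t => if A.Asks P U x t then (1 : ℝ≥0∞) else 0) t
  rw [if_pos h] at this
  exact this

open Classical in
theorem queryCount_univ : A.queryCount Set.univ P x = ((A.numQueries P x : ℕ∞) : ℝ≥0∞) := by
  have key : ∀ t, Nat.count (A.Asks P Set.univ x) t = (A.answers P x t).length := by
    intro t
    induction t with
    | zero => rfl
    | succ t ih =>
      rw [Nat.count_succ, ih]
      cases hs : A.step x.1 x.2 (A.answers P x t) <;> simp [answers, hs, Asks]
  rw [queryCount, ENNReal.tsum_eq_iSup_nat, numQueries, ENat.toENNReal_iSup]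
  refine iSup_congr fun t => ?_
  rw [← key, Nat.count_eq_card_filter_range, Finset.card_filter]
  simp

/-- A query involves at most two elements, so the numbers of queries involving the single elements
add up to at most twice the number of queries. -/
theorem sum_queryCount_le (F : Finset (Fin n)) :
    ∑ v ∈ F, A.queryCount {q | q.1 = v ∨ q.2 = v} P x ≤
      2 * ((A.numQueries P x : ℕ∞) : ℝ≥0∞) := by
  classical
  refine le_trans ?_ (mul_le_mul_right queryCount_univ.le 2)
  simp only [queryCount]
  rw [← Summable.tsum_finsetSum fun _ _ => ENNReal.summable, ← ENNReal.tsum_mul_left]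
  refine ENNReal.tsum_le_tsum fun t => ?_
  by_cases hs : A.Asks P Set.univ x t
  · obtain ⟨q, -, hq⟩ := id hs
    rw [if_pos hs, mul_one]
    calc ∑ v ∈ F, (if A.Asks P {q | q.1 = v ∨ q.2 = v} x t then (1 : ℝ≥0∞) else 0)
        ≤ ∑ v ∈ F, ((if q.1 = v then 1 else 0) + (if q.2 = v then 1 else 0)) := by
          refine Finset.sum_le_sum fun v _ => ?_
          split_ifs with h h1 h2 h2 <;> try simp
          obtain ⟨q', hq', e⟩ := h
          rw [hq] at e
          cases Sum.inl_injective e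
          simp_all
      _ ≤ 1 + 1 := by
          rw [Finset.sum_add_distrib]
          gcongr <;> rw [Finset.sum_ite_eq] <;> split_ifs <;> simp
      _ = 2 := one_add_one_eq_two
  · have : ∀ v, ¬ A.Asks P {q | q.1 = v ∨ q.2 = v} x t :=
      fun v h => hs (h.mono (Set.subset_univ _))
    simp [this]

open Classical in
/-- Suppose that the clusterings `P i` differ from a reference clustering `P₀` only in the pairs of
disjoint sets `D i ⊆ U`. For a fixed seed and matrix, the run on `P i` follows the run on `P₀` until
that one first meets `D i`. At most one `D i` is never met, as the run on `P₀` returns only one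
clustering; the others are met at different times. So only few `i` are found by few queries. -/
theorem card_queryCount_lt_le {I : Type*} [Fintype I] {P₀ : Clustering n} {P : I → Clustering n}
    (hP : Function.Injective P) {D : I → Set (Fin n × Fin n)} (hDU : ∀ i, D i ⊆ U)
    (hdisj : ∀ i j q, q ∈ D i → q ∈ D j → i = j)
    (hD : ∀ i q, q ∉ D i → ((P i).Same q.1 q.2 ↔ P₀.Same q.1 q.2))
    (hret : ∀ i, A.Returns (P i) x (P i)) (s : ℕ) :
    (Finset.univ.filter fun i => A.queryCount U (P i) x < s).card ≤ s := by
  rcases Nat.eq_zero_or_pos s with rfl | hs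
  · simp
  let hit : I → Prop := fun i => ∃ t, A.Asks P₀ (D i) x t
  let τ : I → ℕ := fun i => if h : hit i then Nat.find h else 0
  have hτ : ∀ i, hit i → A.Asks P₀ (D i) x (τ i) := fun i h => by
    simpa [τ, h] using Nat.find_spec h
  have hτmin : ∀ i, hit i → ∀ t < τ i, ¬ A.Asks P₀ (D i) x t := fun i h t ht => by
    simp only [τ, h, dif_pos] at ht
    exact Nat.find_min h ht
  have hcount : ∀ i, hit i → A.queryCount U (P i) x < s →
      Nat.count (A.Asks P₀ U x) (τ i) < s - 1 := by
    intro i h hlt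
    have e : Nat.count (A.Asks (P i) U x) (τ i + 1) = Nat.count (A.Asks P₀ U x) (τ i + 1) := by
      simp only [Nat.count_eq_card_filter_range]
      congr 1
      refine Finset.filter_congr fun t ht => ?_
      rw [Finset.mem_range] at ht
      have := answers_congr (hD i) (T := t) fun t' ht' => hτmin i h t' (by omega)
      simp only [Asks, this]
    have h2 := (count_le_queryCount (A := A) (U := U) (P := P i) (x := x) (τ i + 1)).trans_lt hlt
    rw [e, Nat.count_succ_eq_succ_count ((hτ i h).mono (hDU i))] at h2
    have h3 : Nat.count (A.Asks P₀ U x) (τ i) + 1 < s := by exact_mod_cast h2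
    omega
  refine (Finset.card_le_card_of_injOn
    (fun i => if hit i then Nat.count (A.Asks P₀ U x) (τ i) else s - 1) (t := Finset.range s)
    ?_ ?_).trans_eq (Finset.card_range s)
  · intro i hi
    simp only [Finset.coe_filter, Finset.mem_univ, true_and, Set.mem_ofPred_eq] at hi
    by_cases h : hit i
    · have := hcount i h hi
      simp only [h, if_true, Finset.coe_range, Set.mem_Iio]
      omega
    · simp only [h, if_false, Finset.coe_range, Set.mem_Iio]
      omega
  · intro i hi j hj hij
    simp only [Finset.coe_filter, Finset.mem_univ, true_and, Set.mem_ofPred_eq] at hi hj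
    by_cases h : hit i <;> by_cases h' : hit j <;> simp only [h, h', if_true, if_false] at hij
    · have e := Nat.count_injective ((hτ i h).mono (hDU i)) ((hτ j h').mono (hDU j)) hij
      obtain ⟨q, hq, hs⟩ := hτ i h
      obtain ⟨q', hq', hs'⟩ := hτ j h'
      rw [e, hs'] at hs
      cases Sum.inl_injective hs
      exact hdisj i j _ hq hq'
    · exact absurd hij (hcount i h hi).ne
    · exact absurd hij.symm (hcount j h' hj).ne
    · exact hP (((hret i).congr (hD i) fun t ht => h ⟨t, ht⟩).unique
        ((hret j).congr (hD j) fun t ht => h' ⟨t, ht⟩))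

/-- To rule out a clustering that differs from `P` only inside `D`, a pair from `D` has to be
queried. -/
theorem one_le_queryCount_of_ne (hne : P' ≠ P)
    (hD : ∀ q, q ∉ D → (P'.Same q.1 q.2 ↔ P.Same q.1 q.2))
    (hP : A.Returns P x P) (hP' : A.Returns P' x P') : 1 ≤ A.queryCount D P x := by
  by_contra h
  have hno : ∀ t, ¬ A.Asks P D x t := fun t ht => h (one_le_queryCount ht)
  exact hne ((hP'.congr hD hno).unique hP)

/-! ### Measurability of the run -/

theorem measurableSet_answers_eq (A : RandAlg.{u} n) (P : Clustering n) (t : ℕ) (l : List Bool) :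
    MeasurableSet {x | A.answers P x t = l} := by
  induction t generalizing l with
  | zero => exact MeasurableSet.const ([] = l)
  | succ t ih =>
    have : {x | A.answers P x (t + 1) = l} =
        ⋃ l', ⋃ a : (Fin n × Fin n) ⊕ Clustering n, {x | A.answers P x t = l'} ∩
          {x : A.Seed × Similarity n | A.step x.1 x.2 l' = a} ∩
          {_x | (match a with
            | Sum.inl q => l' ++ [decide (P.Same q.1 q.2)]
            | Sum.inr _ => l') = l} := by
      ext x
      simp only [answers, Set.mem_ofPred_eq, Set.mem_iUnion, Set.mem_inter_iff]
      constructor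
      · intro h
        exact ⟨_, _, ⟨rfl, rfl⟩, h⟩
      · rintro ⟨l', a, ⟨rfl, rfl⟩, h⟩
        exact h
    rw [this]
    exact .iUnion fun l' => .iUnion fun a =>
      ((ih l').inter (A.measurable_step l' a)).inter (.const _)

theorem measurableSet_step_answers (A : RandAlg.{u} n) (P : Clustering n) (t : ℕ)
    (p : (Fin n × Fin n) ⊕ Clustering n → Prop) :
    MeasurableSet {x | p (A.step x.1 x.2 (A.answers P x t))} := by
  have : {x | p (A.step x.1 x.2 (A.answers P x t))} =
      ⋃ l', ⋃ a : (Fin n × Fin n) ⊕ Clustering n, {x | A.answers P x t = l'} ∩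
        {x : A.Seed × Similarity n | A.step x.1 x.2 l' = a} ∩ {_x | p a} := by
    ext x
    simp only [Set.mem_ofPred_eq, Set.mem_iUnion, Set.mem_inter_iff]
    constructor
    · intro h
      exact ⟨_, _, ⟨rfl, rfl⟩, h⟩
    · rintro ⟨l', a, ⟨rfl, rfl⟩, h⟩
      exact h
  rw [this]
  exact .iUnion fun l' => .iUnion fun a =>
    ((measurableSet_answers_eq A P t l').inter (A.measurable_step l' a)).inter (.const _)

theorem measurableSet_returns (A : RandAlg.{u} n) (P Q : Clustering n) :
    MeasurableSet {x | A.Returns P x Q} := by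
  simp only [Returns, Set.ofPred_exists]
  exact .iUnion fun t => measurableSet_step_answers A P t (· = Sum.inr Q)

theorem measurable_queryCount (A : RandAlg.{u} n) (U : Set (Fin n × Fin n)) (P : Clustering n) :
    Measurable (A.queryCount U P) := by
  refine Measurable.tsum fun t => ?_
  refine Measurable.ite ?_ measurable_const measurable_const
  exact measurableSet_step_answers A P t fun a => ∃ q ∈ U, a = Sum.inl q

theorem measurable_numQueries (A : RandAlg.{u} n) (P : Clustering n) :
    Measurable fun x => ((A.numQueries P x : ℕ∞) : ℝ≥0∞) := by
  simp only [← queryCount_univ]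
  exact measurable_queryCount A Set.univ P

end RandAlg

/-! ### Hellinger affinity and total variation -/

theorem IsDensity.integrable {ν : Measure ℝ} {f : ℝ → ℝ} (hf : IsDensity ν f) :
    Integrable f ν := by
  refine ⟨hf.measurable.aestronglyMeasurable, ?_⟩
  rw [hasFiniteIntegral_iff_ofReal (ae_of_all _ hf.nonneg), hf.lintegral_eq_one]
  exact ENNReal.one_lt_top

theorem IsDensity.integral_eq_one {ν : Measure ℝ} {f : ℝ → ℝ} (hf : IsDensity ν f) :
    ∫ x, f x ∂ν = 1 := by
  rw [integral_eq_lintegral_of_nonneg_ae (ae_of_all _ hf.nonneg)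
    hf.measurable.aestronglyMeasurable, hf.lintegral_eq_one, ENNReal.toReal_one]

theorem IsDensity.isProbabilityMeasure {ν : Measure ℝ} {f : ℝ → ℝ} (hf : IsDensity ν f) :
    IsProbabilityMeasure (densityLaw ν f) :=
  ⟨by rw [densityLaw, withDensity_apply _ MeasurableSet.univ, setLIntegral_univ,
    hf.lintegral_eq_one]⟩

theorem IsDensity.integrable_sqrt_mul {ν : Measure ℝ} {f g : ℝ → ℝ} (hf : IsDensity ν f)
    (hg : IsDensity ν g) : Integrable (fun x => √(f x * g x)) ν := by
  refine (hf.integrable.add hg.integrable).mono'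
    (hf.measurable.mul hg.measurable).sqrt.aestronglyMeasurable (ae_of_all _ fun x => ?_)
  have h1 := hf.nonneg x
  have h2 := hg.nonneg x
  rw [Real.norm_of_nonneg (Real.sqrt_nonneg _), Pi.add_apply]
  exact Real.sqrt_le_iff.2 ⟨by positivity, by nlinarith⟩

theorem hellinger_nonneg (ν : Measure ℝ) (f g : ℝ → ℝ) : 0 ≤ hellinger ν f g := Real.sqrt_nonneg _

theorem integral_sqrt_mul {ν : Measure ℝ} {f g : ℝ → ℝ} (hf : IsDensity ν f)
    (hg : IsDensity ν g) : ∫ x, √(f x * g x) ∂ν = 1 - hellinger ν f g ^ 2 := by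
  have h0 : 0 ≤ (1 / 2 : ℝ) * ∫ x, (√(f x) - √(g x)) ^ 2 ∂ν :=
    mul_nonneg (by norm_num) (integral_nonneg fun x => sq_nonneg _)
  have h1 : ∀ x, (√(f x) - √(g x)) ^ 2 = f x + g x - 2 * √(f x * g x) := fun x => by
    rw [Real.sqrt_mul (hf.nonneg x), sub_sq, Real.sq_sqrt (hf.nonneg x),
      Real.sq_sqrt (hg.nonneg x)]
    ring
  rw [hellinger, Real.sq_sqrt h0]
  simp only [h1]
  rw [integral_sub (f := fun x => f x + g x) (hf.integrable.add hg.integrable)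
    ((hf.integrable_sqrt_mul hg).const_mul 2), integral_add hf.integrable hg.integrable,
    integral_const_mul, hf.integral_eq_one, hg.integral_eq_one]
  ring

theorem lintegral_pi_prod_ofReal {ι : Type*} [Fintype ι] {ν : Measure ℝ} [SigmaFinite ν]
    {f : ι → ℝ → ℝ} (hf : ∀ i, Integrable (f i) ν) (h0 : ∀ i x, 0 ≤ f i x) :
    ∫⁻ x, ENNReal.ofReal (∏ i, f i (x i)) ∂(Measure.pi fun _ : ι => ν) =
      ∏ i, ∫⁻ x, ENNReal.ofReal (f i x) ∂ν := by
  rw [← ofReal_integral_eq_lintegral_ofReal (Integrable.fintype_prod hf)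
    (ae_of_all _ fun x => Finset.prod_nonneg fun i _ => h0 i _), integral_fintype_prod_eq_prod,
    ENNReal.ofReal_prod_of_nonneg fun i _ => integral_nonneg (h0 i)]
  exact Finset.prod_congr rfl fun i _ =>
    ofReal_integral_eq_lintegral_ofReal (hf i) (ae_of_all _ (h0 i))

theorem pi_densityLaw {ι : Type*} [Fintype ι] {ν : Measure ℝ} [SigmaFinite ν]
    {f : ι → ℝ → ℝ} (hf : ∀ i, IsDensity ν (f i)) :
    Measure.pi (fun i => densityLaw ν (f i)) =
      (Measure.pi fun _ : ι => ν).withDensity fun x => ENNReal.ofReal (∏ i, f i (x i)) := by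
  have := fun i => (hf i).isProbabilityMeasure
  refine Measure.pi_eq fun s hs => ?_
  have hind : ∀ x : ι → ℝ, (Set.univ.pi s).indicator
      (fun x => ENNReal.ofReal (∏ i, f i (x i))) x =
      ENNReal.ofReal (∏ i, (s i).indicator (f i) (x i)) := by
    intro x
    by_cases hx : x ∈ Set.univ.pi s
    · rw [Set.indicator_of_mem hx]
      congr 1
      exact Finset.prod_congr rfl fun i _ => (Set.indicator_of_mem (hx i trivial) _).symm
    · rw [Set.indicator_of_notMem hx]
      simp only [Set.mem_pi, Set.mem_univ, true_imp_iff, not_forall] at hx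
      obtain ⟨i, hi⟩ := hx
      rw [Finset.prod_eq_zero (Finset.mem_univ i) (Set.indicator_of_notMem hi _),
        ENNReal.ofReal_zero]
  rw [withDensity_apply _ (MeasurableSet.univ_pi hs),
    ← lintegral_indicator (MeasurableSet.univ_pi hs)]
  simp only [hind]
  rw [lintegral_pi_prod_ofReal (fun i => (hf i).integrable.indicator (hs i))
    fun i x => Set.indicator_nonneg (fun _ _ => (hf i).nonneg _) _]
  refine Finset.prod_congr rfl fun i _ => ?_
  rw [densityLaw, withDensity_apply _ (hs i), ← lintegral_indicator (hs i)]
  refine lintegral_congr fun x => ?_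
  by_cases hx : x ∈ s i <;> simp [hx]

/-- Cauchy–Schwarz on the event `E`. -/
theorem setLIntegral_sqrt_mul_le {X : Type*} [MeasurableSpace X] {l : Measure X} {p q : X → ℝ}
    (hp : Measurable p) (hq : Measurable q) (hp0 : ∀ x, 0 ≤ p x) (hq0 : ∀ x, 0 ≤ q x) (E : Set X) :
    ∫⁻ x in E, ENNReal.ofReal √(p x * q x) ∂l ≤
      (∫⁻ x in E, ENNReal.ofReal (p x) ∂l) ^ (1 / 2 : ℝ) *
        (∫⁻ x in E, ENNReal.ofReal (q x) ∂l) ^ (1 / 2 : ℝ) := by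
  refine le_trans (le_of_eq ?_) (ENNReal.lintegral_mul_norm_pow_le (μ := l.restrict E)
    hp.ennreal_ofReal.aemeasurable hq.ennreal_ofReal.aemeasurable (p := 1 / 2) (q := 1 / 2)
    (by norm_num) (by norm_num) (by norm_num))
  refine lintegral_congr fun x => ?_
  rw [Real.sqrt_mul (hp0 x), ENNReal.ofReal_mul (Real.sqrt_nonneg _), Real.sqrt_eq_rpow,
    Real.sqrt_eq_rpow, ENNReal.ofReal_rpow_of_nonneg (hp0 x) (by norm_num),
    ENNReal.ofReal_rpow_of_nonneg (hq0 x) (by norm_num)]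

theorem le_add_sqrt_one_sub_sq {a b r : ℝ} (ha : 0 ≤ a) (ha1 : a ≤ 1) (hb : 0 ≤ b) (hb1 : b ≤ 1)
    (hr : 0 ≤ r) (h : r ≤ √a * √b + √(1 - a) * √(1 - b)) : a ≤ b + √(1 - r ^ 2) := by
  have h1 : r ^ 2 ≤ (√a * √b + √(1 - a) * √(1 - b)) ^ 2 := pow_le_pow_left₀ hr h 2
  have e1 := Real.sq_sqrt ha
  have e2 := Real.sq_sqrt hb
  have e3 := Real.sq_sqrt (sub_nonneg.2 ha1)
  have e4 := Real.sq_sqrt (sub_nonneg.2 hb1)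
  -- twice the product of `√(a (1 - a))` and `√(b (1 - b))` is at most the sum of their squares
  have h2 := sq_nonneg (√a * √(1 - a) - √b * √(1 - b))
  have h3 : (√a * √b + √(1 - a) * √(1 - b)) ^ 2 + (√a * √(1 - a) - √b * √(1 - b)) ^ 2 =
      √a ^ 2 * √b ^ 2 + √(1 - a) ^ 2 * √(1 - b) ^ 2 + √a ^ 2 * √(1 - a) ^ 2 +
        √b ^ 2 * √(1 - b) ^ 2 := by ring
  rw [e1, e2, e3, e4] at h3
  have h4 : (a - b) ^ 2 ≤ 1 - r ^ 2 := by nlinarith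
  linarith [Real.le_sqrt_of_sq_le h4]

/-- The total variation distance of two probability measures with affinity at least `r` is at most
`√(1 - r²)`. -/
theorem withDensity_le_add_sqrt {X : Type*} [MeasurableSpace X] {l : Measure X} {p q : X → ℝ}
    (hp : Measurable p) (hq : Measurable q) (hp0 : ∀ x, 0 ≤ p x) (hq0 : ∀ x, 0 ≤ q x)
    (hp1 : ∫⁻ x, ENNReal.ofReal (p x) ∂l = 1) (hq1 : ∫⁻ x, ENNReal.ofReal (q x) ∂l = 1)
    {r : ℝ} (hr0 : 0 ≤ r) (hr : ENNReal.ofReal r ≤ ∫⁻ x, ENNReal.ofReal √(p x * q x) ∂l)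
    {E : Set X} (hE : MeasurableSet E) :
    l.withDensity (fun x => ENNReal.ofReal (p x)) E ≤
      l.withDensity (fun x => ENNReal.ofReal (q x)) E + ENNReal.ofReal √(1 - r ^ 2) := by
  rw [withDensity_apply _ hE, withDensity_apply _ hE]
  have key : ∀ f : X → ℝ, ∫⁻ x, ENNReal.ofReal (f x) ∂l = 1 → ∃ a : ℝ, 0 ≤ a ∧ a ≤ 1 ∧
      ∫⁻ x in E, ENNReal.ofReal (f x) ∂l = ENNReal.ofReal a ∧
      ∫⁻ x in Eᶜ, ENNReal.ofReal (f x) ∂l = ENNReal.ofReal (1 - a) := by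
    intro f hf
    have hsum := lintegral_add_compl (μ := l) (fun x => ENNReal.ofReal (f x)) hE
    rw [hf] at hsum
    have hle : ∫⁻ x in E, ENNReal.ofReal (f x) ∂l ≤ 1 := hsum ▸ le_self_add
    have hfin : ∫⁻ x in E, ENNReal.ofReal (f x) ∂l ≠ ⊤ := (hle.trans_lt ENNReal.one_lt_top).ne
    refine ⟨(∫⁻ x in E, ENNReal.ofReal (f x) ∂l).toReal, ENNReal.toReal_nonneg,
      ENNReal.toReal_le_of_le_ofReal zero_le_one (by simpa using hle),
      (ENNReal.ofReal_toReal hfin).symm, ?_⟩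
    rw [ENNReal.ofReal_sub _ ENNReal.toReal_nonneg, ENNReal.ofReal_toReal hfin, ENNReal.ofReal_one]
    exact ENNReal.eq_sub_of_add_eq hfin (by rw [add_comm]; exact hsum)
  obtain ⟨a, ha, ha1, ea, ea'⟩ := key p hp1
  obtain ⟨b, hb, hb1, eb, eb'⟩ := key q hq1
  have h1 := setLIntegral_sqrt_mul_le (l := l) hp hq hp0 hq0 E
  have h2 := setLIntegral_sqrt_mul_le (l := l) hp hq hp0 hq0 Eᶜ
  rw [ea, eb, ENNReal.ofReal_rpow_of_nonneg ha (by norm_num),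
    ENNReal.ofReal_rpow_of_nonneg hb (by norm_num), ← Real.sqrt_eq_rpow, ← Real.sqrt_eq_rpow,
    ← ENNReal.ofReal_mul (Real.sqrt_nonneg _)] at h1
  rw [ea', eb', ENNReal.ofReal_rpow_of_nonneg (sub_nonneg.2 ha1) (by norm_num),
    ENNReal.ofReal_rpow_of_nonneg (sub_nonneg.2 hb1) (by norm_num), ← Real.sqrt_eq_rpow,
    ← Real.sqrt_eq_rpow, ← ENNReal.ofReal_mul (Real.sqrt_nonneg _)] at h2
  rw [← lintegral_add_compl _ hE] at hr
  have h3 := hr.trans (add_le_add h1 h2)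
  rw [← ENNReal.ofReal_add (by positivity) (by positivity),
    ENNReal.ofReal_le_ofReal_iff (by positivity)] at h3
  rw [ea, eb, ← ENNReal.ofReal_add hb (Real.sqrt_nonneg _)]
  exact ENNReal.ofReal_le_ofReal (le_add_sqrt_one_sub_sq ha ha1 hb hb1 hr0 h3)

/-! ### The law of the similarity matrix -/

/-- The pairs that are in the same cluster for exactly one of the two clusterings. -/
noncomputable def diffPairs {n : ℕ} (P P' : Clustering n) : Finset (Pair n) :=
  Finset.univ.filter fun p => ¬(P.Same p.1.1 p.1.2 ↔ P'.Same p.1.1 p.1.2)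

/-- The density of the entry `p` of the similarity matrix, if the clustering is `P`. -/
noncomputable def entryDensity {n : ℕ} (fg fr : ℝ → ℝ) (P : Clustering n) (p : Pair n) : ℝ → ℝ :=
  if P.Same p.1.1 p.1.2 then fg else fr

/-- The density of the similarity matrix with respect to the product of the reference measures. -/
noncomputable def similarityDensity {n : ℕ} (fg fr : ℝ → ℝ) (P : Clustering n)
    (w : Similarity n) : ℝ :=
  ∏ p, entryDensity fg fr P p (w p)

section

variable {n : ℕ} {ν : Measure ℝ} {fg fr : ℝ → ℝ}

theorem isDensity_entryDensity (hg : IsDensity ν fg) (hr : IsDensity ν fr) (P : Clustering n)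
    (p : Pair n) : IsDensity ν (entryDensity fg fr P p) := by
  unfold entryDensity
  split_ifs <;> assumption

theorem similarityLaw_eq [SigmaFinite ν] (hg : IsDensity ν fg) (hr : IsDensity ν fr)
    (P : Clustering n) :
    similarityLaw ν fg fr P = (Measure.pi fun _ : Pair n => ν).withDensity
      fun w => ENNReal.ofReal (similarityDensity fg fr P w) := by
  have := pi_densityLaw fun p => isDensity_entryDensity hg hr P p
  rw [similarityLaw]
  refine Eq.trans (congrArg Measure.pi (funext fun p => ?_)) this
  unfold entryDensity
  split_ifs <;> rfl

theorem measurable_similarityDensity (hg : IsDensity ν fg) (hr : IsDensity ν fr)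
    (P : Clustering n) : Measurable (similarityDensity fg fr P) :=
  Finset.measurable_prod _ fun p _ =>
    (isDensity_entryDensity hg hr P p).measurable.comp (measurable_pi_apply p)

theorem isProbabilityMeasure_similarityLaw (hg : IsDensity ν fg) (hr : IsDensity ν fr)
    (P : Clustering n) : IsProbabilityMeasure (similarityLaw ν fg fr P) := by
  have : ∀ p : Pair n, IsProbabilityMeasure
      (if P.Same p.1.1 p.1.2 then densityLaw ν fg else densityLaw ν fr) := fun p => by
    split_ifs
    exacts [hg.isProbabilityMeasure, hr.isProbabilityMeasure]
  unfold similarityLaw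
  infer_instance

theorem similarityLaw_le_add [SigmaFinite ν] (hg : IsDensity ν fg) (hr : IsDensity ν fr)
    (hH : hellinger ν fg fr < 1) (P P' : Clustering n) {E : Set (Similarity n)}
    (hE : MeasurableSet E) :
    similarityLaw ν fg fr P E ≤ similarityLaw ν fg fr P' E +
      ENNReal.ofReal √(1 - ((1 - hellinger ν fg fr ^ 2) ^ (diffPairs P P').card) ^ 2) := by
  have hH0 := hellinger_nonneg ν fg fr
  have hρ : 0 ≤ 1 - hellinger ν fg fr ^ 2 := by nlinarith
  have hd := fun P => isDensity_entryDensity (n := n) hg hr P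
  have hnn : ∀ (P : Clustering n) w, 0 ≤ similarityDensity fg fr P w := fun P w =>
    Finset.prod_nonneg fun p _ => (hd P p).nonneg _
  have h1 : ∀ P : Clustering n, ∫⁻ w, ENNReal.ofReal (similarityDensity fg fr P w)
      ∂(Measure.pi fun _ : Pair n => ν) = 1 := fun P => by
    refine (lintegral_pi_prod_ofReal (fun p => (hd P p).integrable)
      fun p => (hd P p).nonneg).trans ?_
    exact Finset.prod_eq_one fun p _ => (hd P p).lintegral_eq_one
  rw [similarityLaw_eq hg hr, similarityLaw_eq hg hr]
  refine withDensity_le_add_sqrt (measurable_similarityDensity hg hr P)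
    (measurable_similarityDensity hg hr P') (hnn P) (hnn P') (h1 P) (h1 P')
    (pow_nonneg hρ _) ?_ hE
  -- the affinity is multiplicative, and only the entries in `diffPairs` contribute
  have h2 : ∀ w, √(similarityDensity fg fr P w * similarityDensity fg fr P' w) =
      ∏ p, √(entryDensity fg fr P p (w p) * entryDensity fg fr P' p (w p)) := fun w => by
    rw [similarityDensity, similarityDensity, ← Finset.prod_mul_distrib,
      Real.sqrt_prod _ fun p _ => mul_nonneg ((hd P p).nonneg _) ((hd P' p).nonneg _)]
  simp only [h2]
  rw [lintegral_pi_prod_ofReal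
    (f := fun p x => √(entryDensity fg fr P p x * entryDensity fg fr P' p x))
    (fun p => (hd P p).integrable_sqrt_mul (hd P' p)) fun p x => Real.sqrt_nonneg _]
  have h3 : ∀ p, ∫⁻ x, ENNReal.ofReal √(entryDensity fg fr P p x * entryDensity fg fr P' p x) ∂ν =
      if p ∈ diffPairs P P' then ENNReal.ofReal (1 - hellinger ν fg fr ^ 2) else 1 := fun p => by
    have e := integral_sqrt_mul hg hr
    have hm : p ∈ diffPairs P P' ↔ ¬(P.Same p.1.1 p.1.2 ↔ P'.Same p.1.1 p.1.2) := by
      simp only [diffPairs, Finset.mem_filter, Finset.mem_univ, true_and]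
    have e' : ∫⁻ x, ENNReal.ofReal √(fg x * fr x) ∂ν =
        ENNReal.ofReal (1 - hellinger ν fg fr ^ 2) := by
      rw [← e, ofReal_integral_eq_lintegral_ofReal (hg.integrable_sqrt_mul hr)
        (ae_of_all _ fun x => Real.sqrt_nonneg _)]
    unfold entryDensity
    by_cases hp : P.Same p.1.1 p.1.2 <;> by_cases hp' : P'.Same p.1.1 p.1.2
    · rw [if_pos hp, if_pos hp', if_neg (by tauto)]
      simp only [Real.sqrt_mul_self (hg.nonneg _)]
      exact hg.lintegral_eq_one
    · rw [if_pos hp, if_neg hp', if_pos (by tauto), e']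
    · rw [if_neg hp, if_pos hp', if_pos (by tauto), ← e']
      simp only [mul_comm (fr _)]
    · rw [if_neg hp, if_neg hp', if_neg (by tauto)]
      simp only [Real.sqrt_mul_self (hr.nonneg _)]
      exact hr.lintegral_eq_one
  simp only [h3]
  rw [Finset.prod_ite_mem, Finset.univ_inter, Finset.prod_const, ENNReal.ofReal_pow hρ]

end

/-! ### Clusterings given by colorings -/

open Classical in
/-- The clustering of `Fin n` into the nonempty color classes of `f`. -/
noncomputable def ofColoring {n : ℕ} (f : Fin n → ℕ) : Clustering n :=
  Finpartition.ofSetoid (Setoid.ker f)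

theorem same_ofColoring {n : ℕ} {f : Fin n → ℕ} {u v : Fin n} :
    (ofColoring f).Same u v ↔ f u = f v := by
  classical
  have h := (ofColoring f).mem_part_iff_part_eq_part (Finset.mem_univ u) (Finset.mem_univ v)
  rw [Clustering.Same, ← h, ofColoring, Finpartition.mem_part_ofSetoid_iff_rel, eq_comm]
  rfl

theorem card_parts_ofColoring {n : ℕ} {f : Fin n → ℕ} {s : Finset ℕ}
    (hs : ∀ c, c ∈ s ↔ ∃ v, f v = c) : (ofColoring f).parts.card = s.card := by
  classical
  have himg : (ofColoring f).parts = Finset.univ.image (ofColoring f).part := by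
    ext p
    simp only [Finset.mem_image, Finset.mem_univ, true_and]
    constructor
    · intro hp
      obtain ⟨v, hv⟩ := (ofColoring f).nonempty_of_mem_parts hp
      exact ⟨v, (ofColoring f).part_eq_of_mem hp hv⟩
    · rintro ⟨v, rfl⟩
      exact (ofColoring f).part_mem.2 (Finset.mem_univ v)
  have hs' : s = Finset.univ.image f := by
    ext c
    simp [hs]
  have key : ∀ u v, (ofColoring f).part u = (ofColoring f).part v ↔ f u = f v :=
    fun u v => same_ofColoring
  rw [himg, hs']
  refine Finset.card_bij' (fun p hp => f (Finset.mem_image.1 hp).choose)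
    (fun c hc => (ofColoring f).part (Finset.mem_image.1 hc).choose)
    (fun p hp => Finset.mem_image_of_mem _ (Finset.mem_univ _))
    (fun c hc => Finset.mem_image_of_mem _ (Finset.mem_univ _)) ?_ ?_
  · intro p hp
    have h1 := (Finset.mem_image.1 hp).choose_spec.2
    generalize_proofs h2 h3
    exact ((key _ _).2 h3.choose_spec.2).trans h1
  · intro c hc
    have h1 := (Finset.mem_image.1 hc).choose_spec.2
    generalize_proofs h2 h3
    exact ((key _ _).1 h3.choose_spec.2).trans h1

/-! ### Experiments in which close clusterings are hard to tell apart -/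

/-- The seed and the matrix have law `Q P` if the clustering is `P`. Almost surely under each of
these laws, the algorithm is correct for *all* clusterings into `k` clusters, and the distance of
two laws is controlled by `h` as for product measures with Hellinger divergence `h`. -/
structure IsExperiment {n : ℕ} (A : RandAlg.{u} n) (k : ℕ) (h : ℝ)
    (Q : Clustering n → Measure (A.Seed × Similarity n)) : Prop where
  isProbabilityMeasure : ∀ P, IsProbabilityMeasure (Q P)
  returns : ∀ P, ∀ᵐ x ∂(Q P), ∀ P' : Clustering n, P'.parts.card = k → A.Returns P' x P'
  le_add : ∀ P P' E, MeasurableSet E →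
    Q P E ≤ Q P' E + ENNReal.ofReal √(1 - ((1 - h ^ 2) ^ (diffPairs P P').card) ^ 2)

theorem exists_le_of_card_mul_le_sum {I : Type*} [Fintype I] [Nonempty I] {b : ℝ≥0∞}
    {g : I → ℝ≥0∞} (h : Fintype.card I * b ≤ ∑ i, g i) : ∃ i, b ≤ g i := by
  by_contra! hlt
  have := ENNReal.sum_lt_sum_of_nonempty (s := Finset.univ) Finset.univ_nonempty
    fun i _ => hlt i
  rw [Finset.sum_const, nsmul_eq_mul, Finset.card_univ] at this
  exact absurd h this.not_ge

/-- Each `v` is resampled by `φ ↦ Function.update φ v i`, uniformly over `i`. -/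
theorem sum_sum_update {α : Type*} [Fintype α] [DecidableEq α] {K : ℕ} (v : α)
    (G : (α → Fin K) → ℝ≥0∞) :
    ∑ φ : α → Fin K, ∑ i, G (Function.update φ v i) = K * ∑ φ, G φ := by
  have hinv : Function.Involutive fun p : (α → Fin K) × Fin K =>
      (Function.update p.1 v p.2, p.1 v) := fun p => by simp
  rw [← Fintype.sum_prod_type' (f := fun φ i => G (Function.update φ v i))]
  refine (Equiv.sum_comp hinv.toPerm fun p : (α → Fin K) × Fin K => G p.1).trans ?_
  rw [Fintype.sum_prod_type, Finset.mul_sum]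
  simp

namespace IsExperiment

variable {n : ℕ} {A : RandAlg.{u} n} {k : ℕ} {h : ℝ}
  {Q : Clustering n → Measure (A.Seed × Similarity n)}

/-- The averaged form of `RandAlg.card_queryCount_lt_le`: if the clusterings `P i` are hard to tell
from the reference clustering `P₀`, then on average over `i` many queries are needed. -/
theorem le_sum_lintegral_queryCount (hQ : IsExperiment A k h Q) {I : Type*} [Fintype I]
    {P₀ : Clustering n} {P : I → Clustering n} (hP : Function.Injective P)
    (hk : ∀ i, (P i).parts.card = k) {U : Set (Fin n × Fin n)} {D : I → Set (Fin n × Fin n)}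
    (hDU : ∀ i, D i ⊆ U) (hdisj : ∀ i j q, q ∈ D i → q ∈ D j → i = j)
    (hD : ∀ i q, q ∉ D i → ((P i).Same q.1 q.2 ↔ P₀.Same q.1 q.2)) {d : ℝ}
    (hd : ∑ i, √(1 - ((1 - h ^ 2) ^ (diffPairs (P i) P₀).card) ^ 2) ≤ d) (s : ℕ) :
    ENNReal.ofReal (s * (Fintype.card I - s - d)) ≤
      ∑ i, ∫⁻ x, A.queryCount U (P i) x ∂(Q (P i)) := by
  classical
  have := hQ.isProbabilityMeasure
  let δ : I → ℝ := fun i => √(1 - ((1 - h ^ 2) ^ (diffPairs (P i) P₀).card) ^ 2)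
  have hd0 : 0 ≤ d := le_trans (Finset.sum_nonneg fun i _ => Real.sqrt_nonneg _) hd
  let E : I → Set (A.Seed × Similarity n) := fun i => {x | A.queryCount U (P i) x < s}
  have hE : ∀ i, MeasurableSet (E i) := fun i =>
    measurableSet_lt (RandAlg.measurable_queryCount A U (P i)) measurable_const
  -- Markov's inequality
  have h1 : ∀ i, (s : ℝ≥0∞) ≤ ∫⁻ x, A.queryCount U (P i) x ∂(Q (P i)) +
      s * (Q P₀ (E i) + ENNReal.ofReal (δ i)) := by
    intro i
    have hm := mul_meas_ge_le_lintegral (μ := Q (P i)) (RandAlg.measurable_queryCount A U (P i)) s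
    have hc : {x | (s : ℝ≥0∞) ≤ A.queryCount U (P i) x} = (E i)ᶜ := by
      ext x
      simp [E]
    rw [hc] at hm
    calc (s : ℝ≥0∞) = s * (Q (P i) (E i)ᶜ + Q (P i) (E i)) := by
          rw [add_comm, measure_add_measure_compl (hE i), measure_univ, mul_one]
      _ ≤ _ := by
          rw [mul_add]
          exact add_le_add hm (mul_le_mul_right (hQ.le_add _ _ _ (hE i)) _)
  have h2 : ∑ i, Q P₀ (E i) ≤ s := by
    calc ∑ i, Q P₀ (E i) = ∫⁻ x, ∑ i, (E i).indicator 1 x ∂(Q P₀) := by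
          rw [lintegral_finsetSum _ fun i _ => measurable_one.indicator (hE i)]
          simp [hE]
      _ ≤ ∫⁻ _, s ∂(Q P₀) := by
          refine lintegral_mono_ae ?_
          filter_upwards [hQ.returns P₀] with x hx
          have := RandAlg.card_queryCount_lt_le (A := A) (x := x) hP hDU hdisj hD
            (fun i => hx _ (hk i)) s
          rw [Finset.card_filter] at this
          have h3 : ((∑ i, if A.queryCount U (P i) x < s then 1 else 0 : ℕ) : ℝ≥0∞) ≤ s := by
            exact_mod_cast this
          refine le_trans (le_of_eq ?_) h3
          push_cast
          refine Finset.sum_congr rfl fun i _ => ?_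
          simp [E, Set.indicator_apply]
      _ = s := by simp
  have h4 : (Fintype.card I * s : ℝ≥0∞) ≤ ∑ i, ∫⁻ x, A.queryCount U (P i) x ∂(Q (P i)) +
      s * (s + ENNReal.ofReal d) := by
    calc (Fintype.card I * s : ℝ≥0∞) = ∑ _i : I, (s : ℝ≥0∞) := by simp
      _ ≤ _ := Finset.sum_le_sum fun i _ => h1 i
      _ ≤ _ := by
        rw [Finset.sum_add_distrib, ← Finset.mul_sum, Finset.sum_add_distrib,
          ← ENNReal.ofReal_sum_of_nonneg fun i _ => Real.sqrt_nonneg _]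
        gcongr
  have e1 : (s * (Fintype.card I - s - d) : ℝ) = Fintype.card I * s - s * (s + d) := by ring
  rw [e1, ENNReal.ofReal_sub _ (by positivity), tsub_le_iff_right]
  rw [ENNReal.ofReal_mul (by positivity), ENNReal.ofReal_mul (by positivity),
    ENNReal.ofReal_add (by positivity) hd0]
  simpa using h4

/-- Every element of a cluster that has other elements has to be queried. -/
theorem exists_half_sub_le (hQ : IsExperiment A k h Q) (hk : 2 ≤ k) (hkn : k < n) :
    ∃ P : Clustering n, P.parts.card = k ∧ ENNReal.ofReal ((n - k : ℝ) / 2) ≤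
      ∫⁻ x, ((A.numQueries P x : ℕ∞) : ℝ≥0∞) ∂(Q P) := by
  have := hQ.isProbabilityMeasure
  let f : Fin n → ℕ := fun v => if v.val < k then v.val else 0
  have hcard : (ofColoring f).parts.card = k := by
    refine (card_parts_ofColoring (s := Finset.range k) fun c => ?_).trans (Finset.card_range k)
    rw [Finset.mem_range]
    refine ⟨fun hc => ⟨⟨c, by omega⟩, if_pos hc⟩, ?_⟩
    rintro ⟨v, rfl⟩
    simp only [f]
    split_ifs <;> omega
  refine ⟨ofColoring f, hcard, ?_⟩
  let F : Finset (Fin n) := Finset.univ.filter fun v => k ≤ v.val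
  have hF : F.card = n - k := by
    have e : F = Finset.Ici ⟨k, hkn⟩ := by
      ext v
      simp [F, Fin.le_def]
    rw [e, Fin.card_Ici]
  have hx : ∀ᵐ x ∂(Q (ofColoring f)), ENNReal.ofReal ((n - k : ℝ) / 2) ≤
      ((A.numQueries (ofColoring f) x : ℕ∞) : ℝ≥0∞) := by
    filter_upwards [hQ.returns (ofColoring f)] with x hx
    have h1 : ∀ u ∈ F, 1 ≤ A.queryCount {q | q.1 = u ∨ q.2 = u} (ofColoring f) x := by
      intro u hu
      have hu : k ≤ u.val := by simpa [F] using hu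
      -- the clustering in which `u` is moved to the cluster of `1`
      let g : Fin n → ℕ := Function.update f u 1
      have hg : ∀ v, v ≠ u → g v = f v := fun v hv => Function.update_of_ne hv _ _
      have hgu : g u = 1 := Function.update_self ..
      refine RandAlg.one_le_queryCount_of_ne (P' := ofColoring g) ?_ ?_ (hx _ hcard) (hx _ ?_)
      · intro e
        have h1 : (ofColoring f).Same u ⟨1, by omega⟩ ↔ (ofColoring g).Same u ⟨1, by omega⟩ := by
          rw [e]
        rw [same_ofColoring, same_ofColoring, hgu,
          hg _ (by rw [Ne, Fin.ext_iff]; simp; omega)] at h1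
        simp only [f] at h1
        rw [if_neg (by omega), if_pos (by omega)] at h1
        omega
      · intro q hq
        simp only [Set.mem_ofPred_eq, not_or] at hq
        rw [same_ofColoring, same_ofColoring, hg _ hq.1, hg _ hq.2]
      · refine (card_parts_ofColoring (s := Finset.range k) fun c => ?_).trans
          (Finset.card_range k)
        rw [Finset.mem_range]
        refine ⟨fun hc => ⟨⟨c, by omega⟩, (hg _ (by rw [Ne, Fin.ext_iff]; simp; omega)).trans
          (if_pos hc)⟩, ?_⟩
        rintro ⟨v, rfl⟩
        by_cases hv : v = u
        · rw [hv, hgu]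
          omega
        · rw [hg v hv]
          simp only [f]
          split_ifs <;> omega
    have h2 := (Finset.sum_le_sum h1).trans (RandAlg.sum_queryCount_le F)
    rw [Finset.sum_const, nsmul_eq_mul, mul_one, hF] at h2
    have e : ENNReal.ofReal ((n - k : ℝ) / 2) = ((n - k : ℕ) : ℝ≥0∞) / 2 := by
      rw [ENNReal.ofReal_div_of_pos two_pos, ← Nat.cast_sub hkn.le, ENNReal.ofReal_natCast]
      simp
    rw [e]
    exact ENNReal.div_le_of_le_mul' h2
  calc _ = ∫⁻ _, ENNReal.ofReal ((n - k : ℝ) / 2) ∂(Q (ofColoring f)) := by simp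
    _ ≤ _ := lintegral_mono_ae hx

end IsExperiment

/-! ### Lower bounds for experiments -/

/-- By Bernoulli's inequality and `√y ≤ 2 y + 1 / 8`; the bound is linear in `d`, so it can be
summed over clusters of different sizes. -/
theorem sqrt_one_sub_pow_sq_le {h : ℝ} (h0 : 0 ≤ h) (h1 : h ≤ 1) (d : ℕ) :
    √(1 - ((1 - h ^ 2) ^ d) ^ 2) ≤ 4 * h ^ 2 * d + 1 / 8 := by
  have hb := one_add_mul_le_pow (a := -h ^ 2) (by nlinarith) (d * 2)
  rw [pow_mul] at hb
  push_cast at hb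
  have hy : 1 - ((1 - h ^ 2) ^ d) ^ 2 ≤ 2 * h ^ 2 * d := by
    have : (1 + -h ^ 2) = 1 - h ^ 2 := by ring
    rw [this] at hb
    linarith
  refine Real.sqrt_le_iff.2 ⟨by positivity, hy.trans ?_⟩
  nlinarith [sq_nonneg (4 * h ^ 2 * d - 1 / 8)]

theorem sqrt_one_sub_pow_sq_le_of_le_one {h η : ℝ} (h0 : 0 ≤ h) (hη : h ≤ η) (hη1 : η < 1) {d : ℕ}
    (hd : d ≤ 1) : √(1 - ((1 - h ^ 2) ^ d) ^ 2) ≤ √(1 - (1 - η ^ 2) ^ 2) := by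
  refine Real.sqrt_le_sqrt (sub_le_sub_left (pow_le_pow_left₀ (by nlinarith) ?_ 2) 1)
  calc 1 - η ^ 2 ≤ 1 - h ^ 2 := by nlinarith
    _ ≤ (1 - h ^ 2) ^ d := by
      have h1 : 0 ≤ 1 - h ^ 2 := by nlinarith
      have h2 : 1 - h ^ 2 ≤ 1 := by nlinarith
      exact (pow_one _).symm.le.trans (pow_le_pow_of_le_one h1 h2 hd)

namespace IsExperiment

variable {n : ℕ} {A : RandAlg.{u} n} {k : ℕ} {h : ℝ}
  {Q : Clustering n → Measure (A.Seed × Similarity n)}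

/-- All clusters but one are singletons up to one hidden pair: to find this pair, a constant
fraction of the `k²` candidates has to be tried, as each of them changes the law of a single entry. -/
theorem exists_sq_le (hQ : IsExperiment A k h Q) (hk : 2 ≤ k) (hkn : k < n) {η : ℝ} (h0 : 0 ≤ h)
    (hη : h ≤ η) (hη1 : η < 1) :
    ∃ P : Clustering n, P.parts.card = k ∧
      ENNReal.ofReal ((1 - √(1 - (1 - η ^ 2) ^ 2)) ^ 2 / 36 * (k : ℝ) ^ 2) ≤
        ∫⁻ x, ((A.numQueries P x : ℕ∞) : ℝ≥0∞) ∂(Q P) := by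
  set θ := √(1 - (1 - η ^ 2) ^ 2) with hθ
  have hθ0 : 0 ≤ θ := Real.sqrt_nonneg _
  have hθ1 : θ < 1 := by
    have : 0 < (1 - η ^ 2) ^ 2 := pow_pos (by nlinarith) 2
    exact (Real.sqrt_lt' one_pos).2 (by linarith)
  obtain ⟨a, ha⟩ : ∃ a, a = k / 2 := ⟨_, rfl⟩
  obtain ⟨b, hb⟩ : ∃ b, b = k - a := ⟨_, rfl⟩
  let M : ℝ := a * b
  have hM : 2 * (k : ℝ) ^ 2 ≤ 9 * M ∨ k = 2 := by
    rcases Nat.lt_or_ge 2 k with h3 | h3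
    · left
      have h4 : ((a : ℝ) = b ∨ (a : ℝ) + 1 = b) ∧ (k : ℝ) = a + b ∧ (1 : ℝ) ≤ a := by
        refine ⟨?_, ?_, ?_⟩
        · rcases Nat.mod_two_eq_zero_or_one k with hm | hm
          · left
            have : a = b := by omega
            exact_mod_cast this
          · right
            have : a + 1 = b := by omega
            exact_mod_cast this
        · have : k = a + b := by omega
          exact_mod_cast this
        · have : 1 ≤ a := by omega
          exact_mod_cast this
      obtain ⟨h5 | h5, h6, h7⟩ := h4
      · simp only [M, h6, ← h5]
        nlinarith
      · simp only [M, h6, ← h5]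
        nlinarith
    · right
      omega
  have hk2 : (2 : ℝ) ≤ k := by exact_mod_cast hk
  -- half of the candidates that the similarities cannot exclude
  let s : ℕ := ⌊M * (1 - θ) / 2⌋₊
  rcases Nat.eq_zero_or_pos s with hs | hs
  · -- few candidates: one query suffices for the bound
    obtain ⟨P, hP, hle⟩ := hQ.exists_half_sub_le hk hkn
    refine ⟨P, hP, le_trans (ENNReal.ofReal_le_ofReal ?_) hle⟩
    have h1 : (k : ℝ) + 1 ≤ n := by exact_mod_cast hkn
    have h2 : M * (1 - θ) < 2 := by
      have := Nat.floor_eq_zero.1 hs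
      linarith
    have h3 : (k : ℝ) ^ 2 * (1 - θ) ≤ 9 := by
      rcases hM with hM | hM
      · nlinarith
      · rw [hM]
        norm_num
        linarith
    have h4 : (1 - θ) ^ 2 * (k : ℝ) ^ 2 ≤ 9 := by nlinarith [sq_nonneg (k : ℝ)]
    linarith
  have hs1 : (1 : ℝ) ≤ s := by exact_mod_cast hs
  have hMs : (s : ℝ) ≤ M * (1 - θ) / 2 := Nat.floor_le (by
    have : 0 ≤ M := by positivity
    nlinarith)
  have hMs' : M * (1 - θ) / 2 < s + 1 := Nat.lt_floor_add_one _
  have hMpos : 0 < M := by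
    by_contra hneg
    nlinarith
  have hMk : 2 * (k : ℝ) ^ 2 ≤ 9 * M := by
    rcases hM with hM | hM
    · exact hM
    · have : M = 1 := by
        have h1 : a = 1 := by omega
        have h2 : b = 1 := by omega
        simp [M, h1, h2]
      rw [this] at hMs
      linarith
  -- the pair `(i, a + j)` is hidden in the clustering `P (i, j)`
  let f : Fin n → ℕ := fun v => if v.val < k then v.val else k
  let g : Fin a × Fin b → Fin n → ℕ := fun i v => if v.val = a + i.2.val then i.1.val else f v
  have hPcard : ∀ i, (ofColoring (g i)).parts.card = k := by
    rintro ⟨i, j⟩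
    refine (card_parts_ofColoring (s := (Finset.range (k + 1)).erase (a + j)) fun c => ?_).trans ?_
    · rw [Finset.mem_erase, Finset.mem_range]
      constructor
      · rintro ⟨h1, h2⟩
        refine ⟨⟨c, by omega⟩, ?_⟩
        simp only [g, f]
        split_ifs <;> omega
      · rintro ⟨v, rfl⟩
        simp only [g, f]
        split_ifs <;> omega
    · rw [Finset.card_erase_of_mem (by rw [Finset.mem_range]; omega), Finset.card_range]
      omega
  have hinj : Function.Injective fun i => ofColoring (g i) := by
    rintro ⟨i, j⟩ ⟨i', j'⟩ e
    simp only at e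
    have h1 : (ofColoring (g (i, j))).Same ⟨i, by omega⟩ ⟨a + j, by omega⟩ ↔
        (ofColoring (g (i', j'))).Same ⟨i, by omega⟩ ⟨a + j, by omega⟩ := by rw [e]
    rw [same_ofColoring, same_ofColoring] at h1
    simp only [g, f, Prod.mk.injEq, Fin.ext_iff] at h1 ⊢
    split_ifs at h1 <;> omega
  let D : Fin a × Fin b → Set (Fin n × Fin n) := fun i =>
    {q | q.1.val = i.1 ∧ q.2.val = a + i.2 ∨ q.2.val = i.1 ∧ q.1.val = a + i.2}
  have hD : ∀ i q, q ∉ D i →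
      ((ofColoring (g i)).Same q.1 q.2 ↔ (ofColoring f).Same q.1 q.2) := by
    rintro ⟨i, j⟩ ⟨u, v⟩ hq
    rw [same_ofColoring, same_ofColoring]
    simp only [D, g, f, Set.mem_ofPred_eq] at hq ⊢
    split_ifs <;> omega
  have hdiff : ∀ i, (diffPairs (ofColoring (g i)) (ofColoring f)).card ≤ 1 := by
    intro i
    refine Finset.card_le_one.2 fun p hp p' hp' => ?_
    have key : ∀ p ∈ diffPairs (ofColoring (g i)) (ofColoring f),
        p.1.1.val = i.1 ∧ p.1.2.val = a + i.2 := by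
      intro p hp
      have h1 : p.1 ∈ D i := by
        by_contra h1
        rw [diffPairs, Finset.mem_filter] at hp
        exact hp.2 (hD i _ h1)
      have h2 := p.2
      rw [Fin.lt_def] at h2
      simp only [D, Set.mem_ofPred_eq] at h1
      omega
    obtain ⟨h1, h2⟩ := key p hp
    obtain ⟨h3, h4⟩ := key p' hp'
    exact Subtype.ext (Prod.ext (Fin.ext (h1.trans h3.symm)) (Fin.ext (h2.trans h4.symm)))
  have hsum := hQ.le_sum_lintegral_queryCount (P₀ := ofColoring f) hinj hPcard (U := Set.univ)
    (D := D) (fun i => Set.subset_univ _) (by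
      rintro ⟨i, j⟩ ⟨i', j'⟩ q h1 h2
      simp only [D, Set.mem_ofPred_eq, Prod.mk.injEq, Fin.ext_iff] at h1 h2 ⊢
      omega) hD (d := M * θ) (by
      refine (Finset.sum_le_card_nsmul _ _ θ fun i _ =>
        sqrt_one_sub_pow_sq_le_of_le_one h0 hη hη1 (hdiff i)).trans_eq ?_
      simp [M]) s
  have hcardI : (Fintype.card (Fin a × Fin b) : ℝ) = M := by simp [M]
  have hne : Nonempty (Fin a × Fin b) := by
    rw [← Fintype.card_pos_iff]
    have : (0 : ℝ) < Fintype.card (Fin a × Fin b) := by rw [hcardI]; exact hMpos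
    exact_mod_cast this
  obtain ⟨i, hi⟩ := exists_le_of_card_mul_le_sum
    (b := ENNReal.ofReal ((1 - θ) ^ 2 / 36 * (k : ℝ) ^ 2)) (le_trans (by
      rw [← ENNReal.ofReal_natCast, hcardI, ← ENNReal.ofReal_mul hMpos.le]
      refine ENNReal.ofReal_le_ofReal ?_
      have h1 : M * (1 - θ) / 4 ≤ s := by linarith
      have h2 : M * (1 - θ) / 2 ≤ M - s - M * θ := by linarith
      have h3 : (M * (1 - θ) / 4) * (M * (1 - θ) / 2) ≤ s * (M - s - M * θ) :=
        mul_le_mul h1 h2 (by nlinarith) (by linarith)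
      have h4 : 0 ≤ M * (1 - θ) ^ 2 := by positivity
      nlinarith) hsum)
  refine ⟨_, hPcard i, hi.trans_eq ?_⟩
  simp only [RandAlg.queryCount_univ]

/-- The elements below `k` are known to lie in different clusters, the next `N` elements are put
independently and uniformly into one of the clusters of `1, …, K`, and the others are known to lie
in the cluster of `0`. The similarities between an element and a cluster of the expected size do not
tell whether the element belongs there, so it has to be compared with a constant fraction of the `K`
clusters. -/
theorem exists_mul_le {K N : ℕ} (hQ : IsExperiment A (K + 1) h Q) (hK : 2 ≤ K)
    (hkn : K + 1 + N ≤ n) (h0 : 0 ≤ h) (h1 : h ≤ 1) (hh : 32 * (N + K) * h ^ 2 ≤ K) :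
    ∃ P : Clustering n, P.parts.card = K + 1 ∧ ENNReal.ofReal ((N : ℝ) * K / 24) ≤
        ∫⁻ x, ((A.numQueries P x : ℕ∞) : ℝ≥0∞) ∂(Q P) := by
  classical
  let f : (Fin n → Fin K) → Fin n → ℕ := fun φ v =>
    if v.val < K + 1 then v.val else if v.val < K + 1 + N then φ v + 1 else 0
  let F : Finset (Fin n) := Finset.univ.filter fun v => K + 1 ≤ v.val ∧ v.val < K + 1 + N
  have hF : F.card = N := by
    have e : F.map Fin.valEmbedding = Finset.Ico (K + 1) (K + 1 + N) := by
      ext v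
      simp only [F, Finset.mem_map, Finset.mem_filter, Finset.mem_univ, true_and,
        Fin.valEmbedding_apply, Finset.mem_Ico]
      constructor
      · rintro ⟨w, hw, rfl⟩
        exact hw
      · exact fun hv => ⟨⟨v, by omega⟩, hv, rfl⟩
    rw [← Finset.card_map, e, Nat.card_Ico]
    omega
  have hcard : ∀ φ, (ofColoring (f φ)).parts.card = K + 1 := by
    intro φ
    refine (card_parts_ofColoring (s := Finset.range (K + 1)) fun c => ?_).trans
      (Finset.card_range _)
    rw [Finset.mem_range]
    refine ⟨fun hc => ⟨⟨c, by omega⟩, if_pos hc⟩, ?_⟩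
    rintro ⟨v, rfl⟩
    simp only [f]
    split_ifs <;> omega
  -- the averaged bound for `K` candidates, total distance `K / 4` and the threshold `K / 2`
  let c : ℝ := (K / 2 : ℕ) * (K - (K / 2 : ℕ) - K / 4)
  have hc : (K : ℝ) ^ 2 / 12 ≤ c := by
    have h2 : (K : ℝ) ≤ 3 * (K / 2 : ℕ) := by
      have : K ≤ 3 * (K / 2) := by omega
      exact_mod_cast this
    have h3 : ((K / 2 : ℕ) : ℝ) ≤ K / 2 := Nat.cast_div_le
    have h4 : (K / 3 : ℝ) * (K / 4) ≤ c :=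
      mul_le_mul (by linarith) (by linarith) (by positivity) (by positivity)
    linarith
  -- the comparisons of a single element `u`, whose cluster is resampled
  have hu : ∀ u ∈ F, ∀ φ, ENNReal.ofReal c ≤
      ∑ i, ∫⁻ x, A.queryCount {q | q.1 = u ∨ q.2 = u} (ofColoring (f (Function.update φ u i))) x
        ∂(Q (ofColoring (f (Function.update φ u i)))) := by
    intro u hu φ
    simp only [F, Finset.mem_filter, Finset.mem_univ, true_and] at hu
    let f₀ : Fin n → ℕ := Function.update (f φ) u (K + 1)
    have hf₀ : ∀ v, v ≠ u → f₀ v = f φ v := fun v hv => Function.update_of_ne hv _ _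
    have hf₀u : f₀ u = K + 1 := Function.update_self ..
    have hfi : ∀ i v, v ≠ u → f (Function.update φ u i) v = f φ v := fun i v hv => by
      simp only [f, Function.update_of_ne hv]
    have hfiu : ∀ i, f (Function.update φ u i) u = i + 1 := fun i => by
      simp only [f, Function.update_self]
      rw [if_neg (by omega), if_pos (by omega)]
    have hflt : ∀ v, f φ v < K + 1 := fun v => by
      simp only [f]
      split_ifs <;> omega
    let D : Fin K → Set (Fin n × Fin n) := fun i =>
      {q | q.1 = u ∧ q.2 ≠ u ∧ f φ q.2 = i + 1 ∨ q.2 = u ∧ q.1 ≠ u ∧ f φ q.1 = i + 1}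
    have hD : ∀ i q, q ∉ D i → ((ofColoring (f (Function.update φ u i))).Same q.1 q.2 ↔
        (ofColoring f₀).Same q.1 q.2) := by
      rintro i ⟨v, w⟩ hq
      rw [same_ofColoring, same_ofColoring]
      simp only [D, Set.mem_ofPred_eq, not_or, not_and] at hq ⊢
      by_cases hv : v = u <;> by_cases hw : w = u
      · rw [hv, hw]
        simp
      · have h2 := hq.1 hv hw
        have h3 := hflt w
        rw [hv, hfi i w hw, hf₀ w hw, hfiu, hf₀u]
        omega
      · have h2 := hq.2 hw hv
        have h3 := hflt v
        rw [hw, hfi i v hv, hf₀ v hv, hfiu, hf₀u]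
        omega
      · rw [hfi i v hv, hfi i w hw, hf₀ v hv, hf₀ w hw]
    let V : Fin K → Finset (Fin n) := fun i => Finset.univ.filter fun v => v ≠ u ∧ f φ v = i + 1
    have hdiff : ∀ i, (diffPairs (ofColoring (f (Function.update φ u i))) (ofColoring f₀)).card ≤
        (V i).card := by
      intro i
      have key : ∀ p ∈ diffPairs (ofColoring (f (Function.update φ u i))) (ofColoring f₀),
          p.1 ∈ D i := by
        intro p hp
        by_contra h2
        rw [diffPairs, Finset.mem_filter] at hp
        exact hp.2 (hD i _ h2)
      refine Finset.card_le_card_of_injOn (fun p => if p.1.1 = u then p.1.2 else p.1.1) ?_ ?_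
      · intro p hp
        have h2 := key p hp
        simp only [D, Set.mem_ofPred_eq] at h2
        simp only [V, Finset.coe_filter, Finset.mem_univ, true_and, Set.mem_ofPred_eq]
        split_ifs with h3 <;> tauto
      · intro p hp p' hp' e
        have h2 := key p hp
        have h3 := key p' hp'
        have h4 := p.2
        have h5 := p'.2
        simp only [D, Set.mem_ofPred_eq] at h2 h3
        simp only [Fin.lt_def] at h4 h5
        simp only at e
        refine Subtype.ext (Prod.ext (Fin.ext ?_) (Fin.ext ?_)) <;>
        · simp only [Fin.ext_iff, ne_eq] at h2 h3 e
          split_ifs at e <;> omega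
    have hVsum : ∑ i, (V i).card ≤ N + K := by
      rw [← Finset.card_biUnion]
      · have hsub : (Finset.univ.biUnion V).map Fin.valEmbedding ⊆
            Finset.Ico 1 (K + 1 + N) := by
          intro v hv
          simp only [V, Finset.mem_map, Finset.mem_biUnion, Finset.mem_filter, Finset.mem_univ,
            true_and, Fin.valEmbedding_apply] at hv
          obtain ⟨w, ⟨i, -, hi⟩, rfl⟩ := hv
          rw [Finset.mem_Ico]
          simp only [f] at hi
          split_ifs at hi <;> omega
        have := Finset.card_le_card hsub
        rw [Finset.card_map, Nat.card_Ico] at this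
        omega
      · intro i _ j _ hij
        refine Finset.disjoint_left.2 fun v hv hv' => hij ?_
        simp only [V, Finset.mem_filter] at hv hv'
        exact Fin.ext (by omega)
    have hd : ∑ i, √(1 - ((1 - h ^ 2) ^
        (diffPairs (ofColoring (f (Function.update φ u i))) (ofColoring f₀)).card) ^ 2) ≤
          (K : ℝ) / 4 := by
      calc _ ≤ ∑ i, (4 * h ^ 2 * ((V i).card : ℝ) + 1 / 8) := by
            refine Finset.sum_le_sum fun i _ => (sqrt_one_sub_pow_sq_le h0 h1 _).trans ?_
            have : ((diffPairs (ofColoring (f (Function.update φ u i))) (ofColoring f₀)).card : ℝ)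
              ≤ (V i).card := by exact_mod_cast hdiff i
            gcongr
        _ = 4 * h ^ 2 * ((∑ i, (V i).card : ℕ) : ℝ) + K / 8 := by
            rw [Finset.sum_add_distrib, ← Finset.mul_sum]
            push_cast
            simp
            ring
        _ ≤ 4 * h ^ 2 * ((N + K : ℕ) : ℝ) + K / 8 := by gcongr
        _ ≤ K / 4 := by
            push_cast
            linarith
    have := hQ.le_sum_lintegral_queryCount (P₀ := ofColoring f₀)
      (P := fun i => ofColoring (f (Function.update φ u i))) (U := {q | q.1 = u ∨ q.2 = u})
      (D := D) ?_ (fun i => hcard _) ?_ ?_ hD hd (K / 2)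
    · rwa [Fintype.card_fin] at this
    · intro i j e
      simp only at e
      have hne : (⟨i + 1, by omega⟩ : Fin n) ≠ u := by
        rw [Ne, Fin.ext_iff]
        simp only
        omega
      have h2 : (ofColoring (f (Function.update φ u i))).Same u ⟨i + 1, by omega⟩ ↔
          (ofColoring (f (Function.update φ u j))).Same u ⟨i + 1, by omega⟩ := by rw [e]
      rw [same_ofColoring, same_ofColoring, hfiu, hfiu, hfi i _ hne, hfi j _ hne] at h2
      simp only [f] at h2
      rw [if_pos (by omega)] at h2
      exact Fin.ext (by omega)
    · intro i q hq
      simp only [D, Set.mem_ofPred_eq] at hq ⊢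
      tauto
    · intro i j q hi hj
      simp only [D, Set.mem_ofPred_eq] at hi hj
      refine Fin.ext ?_
      rcases hi with ⟨-, hi, hi'⟩ | ⟨-, hi, hi'⟩ <;> rcases hj with ⟨hj, -, hj'⟩ | ⟨hj, -, hj'⟩
      · omega
      · exact absurd hj hi
      · exact absurd hj hi
      · omega
  have : Nonempty (Fin n → Fin K) := ⟨fun _ => ⟨0, by omega⟩⟩
  have hsum : (Fintype.card (Fin n → Fin K) : ℝ≥0∞) * (N * ENNReal.ofReal c) ≤
      ∑ φ, K * (2 * ∫⁻ x, ((A.numQueries (ofColoring (f φ)) x : ℕ∞) : ℝ≥0∞)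
        ∂(Q (ofColoring (f φ)))) := by
    calc _ = ∑ _u ∈ F, ∑ _φ : Fin n → Fin K, ENNReal.ofReal c := by
          simp only [Finset.sum_const, nsmul_eq_mul, hF, Finset.card_univ]
          ring
      _ ≤ ∑ u ∈ F, ∑ φ : Fin n → Fin K, ∑ i, ∫⁻ x, A.queryCount {q | q.1 = u ∨ q.2 = u}
            (ofColoring (f (Function.update φ u i))) x
              ∂(Q (ofColoring (f (Function.update φ u i)))) :=
          Finset.sum_le_sum fun u hu' => Finset.sum_le_sum fun φ _ => hu u hu' φ
      _ = ∑ u ∈ F, K * ∑ φ : Fin n → Fin K, ∫⁻ x, A.queryCount {q | q.1 = u ∨ q.2 = u}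
            (ofColoring (f φ)) x ∂(Q (ofColoring (f φ))) :=
          Finset.sum_congr rfl fun u _ => sum_sum_update u fun φ =>
            ∫⁻ x, A.queryCount {q | q.1 = u ∨ q.2 = u} (ofColoring (f φ)) x
              ∂(Q (ofColoring (f φ)))
      _ = ∑ φ : Fin n → Fin K, K * ∫⁻ x, ∑ u ∈ F, A.queryCount {q | q.1 = u ∨ q.2 = u}
            (ofColoring (f φ)) x ∂(Q (ofColoring (f φ))) := by
          rw [← Finset.mul_sum, ← Finset.mul_sum, Finset.sum_comm]
          congr 1
          refine Finset.sum_congr rfl fun φ _ => ?_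
          rw [lintegral_finsetSum _ fun u _ => RandAlg.measurable_queryCount A _ _]
      _ ≤ _ := by
          refine Finset.sum_le_sum fun φ _ => mul_le_mul_right ?_ _
          rw [← lintegral_const_mul _ (RandAlg.measurable_numQueries A _)]
          exact lintegral_mono fun x => RandAlg.sum_queryCount_le F
  obtain ⟨φ, hφ⟩ := exists_le_of_card_mul_le_sum hsum
  refine ⟨_, hcard φ, ?_⟩
  have hK0 : (0 : ℝ) < K := by
    have : 0 < K := by omega
    exact_mod_cast this
  have h2K : ENNReal.ofReal (K * 2) ≠ 0 := by
    rw [Ne, ENNReal.ofReal_eq_zero, not_le]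
    positivity
  rw [← mul_assoc, ← ENNReal.ofReal_natCast, ← ENNReal.ofReal_natCast, ← ENNReal.ofReal_ofNat,
    ← ENNReal.ofReal_mul (by positivity), ← ENNReal.ofReal_mul (by positivity)] at hφ
  refine (ENNReal.mul_le_mul_iff_right h2K ENNReal.ofReal_ne_top).1 (le_trans ?_ hφ)
  rw [← ENNReal.ofReal_mul (by positivity)]
  refine ENNReal.ofReal_le_ofReal ?_
  have := mul_le_mul_of_nonneg_left hc (Nat.cast_nonneg (α := ℝ) N)
  nlinarith

end IsExperiment

namespace IsExperiment

variable {n : ℕ} {A : RandAlg.{u} n} {k : ℕ} {h : ℝ}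
  {Q : Clustering n → Measure (A.Seed × Similarity n)}

theorem exists_mul_min_le (hQ : IsExperiment A k h Q) (hk : 2 ≤ k) (hkn : 2 * k ≤ n) {L : ℝ}
    (h0 : 0 ≤ h) (hL : 64 ≤ L) (hLh : L * h ^ 2 ≤ 1) :
    ∃ P : Clustering n, P.parts.card = k ∧
      ENNReal.ofReal (((n : ℝ) + min ((k : ℝ) ^ 2 * L) (n * k)) / 24576) ≤
        ∫⁻ x, ((A.numQueries P x : ℕ∞) : ℝ≥0∞) ∂(Q P) := by
  set m := min ((k : ℝ) ^ 2 * L) (n * k)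
  have hm1 : m ≤ (k : ℝ) ^ 2 * L := min_le_left _ _
  have hm2 : m ≤ n * k := min_le_right _ _
  clear_value m
  have hn : (2 * k : ℝ) ≤ n := by exact_mod_cast hkn
  have hk' : (2 : ℝ) ≤ k := by exact_mod_cast hk
  by_cases hmn : m ≤ 2 * n
  · obtain ⟨P, hP, hle⟩ := hQ.exists_half_sub_le hk (by omega)
    exact ⟨P, hP, le_trans (ENNReal.ofReal_le_ofReal (by linarith)) hle⟩
  · have hk3 : k ≠ 2 := by
      rintro rfl
      push_cast at hm2
      linarith
    obtain ⟨K, rfl⟩ : ∃ K, k = K + 1 := ⟨k - 1, by omega⟩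
    have hK : (2 : ℝ) ≤ K := by
      have : 2 ≤ K := by omega
      exact_mod_cast this
    -- all elements that can be spared, but no more than `L / 64` of them per cluster on average
    let N : ℕ := min (n - (K + 1)) ⌊K * L / 64⌋₊
    have hN : (N : ℝ) ≤ K * L / 64 :=
      le_trans (by exact_mod_cast min_le_right _ _) (Nat.floor_le (by positivity))
    have hh1 : 64 * h ^ 2 ≤ 1 := by nlinarith [sq_nonneg h]
    obtain ⟨P, hP, hle⟩ := hQ.exists_mul_le (N := N) (by omega)
      (by have : N ≤ n - (K + 1) := min_le_left _ _
          omega) h0 (by nlinarith) (by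
        have h2 : (N : ℝ) * h ^ 2 ≤ K * L / 64 * h ^ 2 :=
          mul_le_mul_of_nonneg_right hN (sq_nonneg h)
        nlinarith)
    refine ⟨P, hP, le_trans (ENNReal.ofReal_le_ofReal ?_) hle⟩
    push_cast at hm1 hm2 hn
    have hN' : m / 512 ≤ N * K := by
      rcases le_total (n - (K + 1)) ⌊K * L / 64⌋₊ with h2 | h2
      · have e : (N : ℝ) = n - (K + 1) := by
          have : N = n - (K + 1) := min_eq_left h2
          rw [this, Nat.cast_sub (by omega)]
          push_cast
          ring
        rw [e]
        nlinarith
      · have e : N = ⌊K * L / 64⌋₊ := min_eq_right h2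
        have h3 : K * L / 64 < N + 1 := e ▸ Nat.lt_floor_add_one _
        have h4 : (K : ℝ) * L / 128 ≤ N := by nlinarith
        have h5 : ((K : ℝ) + 1) ^ 2 * L ≤ (2 * K) ^ 2 * L := by gcongr; linarith
        nlinarith
    linarith

/-- The lower bound in the abstract setting; `L` plays the role of `1 / h ^ 2`. -/
theorem exists_bound_le (hQ : IsExperiment A k h Q) (hk : 2 ≤ k) (hkn : k < n) {η L : ℝ}
    (h0 : 0 ≤ h) (hη : h ≤ η) (hη1 : η < 1) (hL : 0 ≤ L) (hLh : L * h ^ 2 ≤ 1) :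
    ∃ P : Clustering n, P.parts.card = k ∧
      ENNReal.ofReal ((1 - √(1 - (1 - η ^ 2) ^ 2)) ^ 2 / 24576 *
        ((n : ℝ) + min ((k : ℝ) ^ 2 * L) (n * k))) ≤
          ∫⁻ x, ((A.numQueries P x : ℕ∞) : ℝ≥0∞) ∂(Q P) := by
  have hk' : (2 : ℝ) ≤ k := by exact_mod_cast hk
  have hkn' : (k : ℝ) < n := by exact_mod_cast hkn
  have hθ0 : 0 ≤ √(1 - (1 - η ^ 2) ^ 2) := Real.sqrt_nonneg _
  have hθ1 : √(1 - (1 - η ^ 2) ^ 2) ≤ 1 :=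
    Real.sqrt_le_one.2 (by nlinarith [sq_nonneg (1 - η ^ 2)])
  obtain ⟨P₂, hP₂, hle₂⟩ := hQ.exists_sq_le hk hkn h0 hη hη1
  set κ := (1 - √(1 - (1 - η ^ 2) ^ 2)) ^ 2 with hκ
  have hκ0 : 0 ≤ κ := sq_nonneg _
  have hκ1 : κ ≤ 1 := pow_le_one₀ (by linarith) (by linarith)
  set m := min ((k : ℝ) ^ 2 * L) (n * k) with hm
  have hm1 : m ≤ (k : ℝ) ^ 2 * L := min_le_left _ _
  have hm2 : m ≤ n * k := min_le_right _ _
  have hm0 : 0 ≤ m := le_min (by positivity) (by positivity)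
  -- if `k ^ 2` dominates, a single hidden pair gives the bound
  have hsq : (n : ℝ) + m ≤ 128 * (k : ℝ) ^ 2 → ∃ P : Clustering n, P.parts.card = k ∧
      ENNReal.ofReal (κ / 24576 * ((n : ℝ) + m)) ≤
          ∫⁻ x, ((A.numQueries P x : ℕ∞) : ℝ≥0∞) ∂(Q P) := fun h2 =>
    ⟨P₂, hP₂, le_trans (ENNReal.ofReal_le_ofReal (by nlinarith)) hle₂⟩
  rcases lt_or_ge n (2 * k) with h2 | h2
  · have h3 : (n : ℝ) < 2 * k := by exact_mod_cast h2
    exact hsq (by nlinarith)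
  rcases le_or_gt 64 L with h3 | h3
  · obtain ⟨P, hP, hle⟩ := hQ.exists_mul_min_le hk h2 h0 h3 hLh
    refine ⟨P, hP, le_trans (ENNReal.ofReal_le_ofReal ?_) hle⟩
    rw [← hm]
    nlinarith
  · have h4 : m ≤ 64 * (k : ℝ) ^ 2 := by nlinarith
    rcases le_total (n : ℝ) (64 * (k : ℝ) ^ 2) with h5 | h5
    · exact hsq (by linarith)
    · obtain ⟨P, hP, hle⟩ := hQ.exists_half_sub_le hk hkn
      refine ⟨P, hP, le_trans (ENNReal.ofReal_le_ofReal ?_) hle⟩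
      have h6 : (2 * k : ℝ) ≤ n := by exact_mod_cast h2
      have h7 : κ * (n + m) ≤ n + m := mul_le_of_le_one_left (by positivity) hκ1
      linarith

end IsExperiment

/-! ### Exact algorithms -/

theorem ae_withDensity_ofReal_iff {X : Type*} [MeasurableSpace X] {l : Measure X} {f : X → ℝ}
    (hf : Measurable f) {p : X → Prop} :
    (∀ᵐ x ∂(l.withDensity fun x => ENNReal.ofReal (f x)), p x) ↔ ∀ᵐ x ∂l, 0 < f x → p x := by
  rw [ae_withDensity_iff hf.ennreal_ofReal]
  simp only [ne_eq, ENNReal.ofReal_eq_zero, not_le]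

namespace RandAlg

variable {n k : ℕ} {A : RandAlg.{u} n} {ν : Measure ℝ} [SigmaFinite ν] {fg fr : ℝ → ℝ}

/-- The common reference measure for the laws of seed and matrix. -/
noncomputable def refMeasure (A : RandAlg.{u} n) (ν : Measure ℝ) :
    Measure (A.Seed × Similarity n) :=
  A.seedLaw.prod (Measure.pi fun _ : Pair n => ν)

theorem law_eq (hg : IsDensity ν fg) (hr : IsDensity ν fr) (P : Clustering n) :
    A.law ν fg fr P = (A.refMeasure ν).withDensity
      fun x => ENNReal.ofReal (similarityDensity fg fr P x.2) := by
  rw [law, similarityLaw_eq hg hr, refMeasure]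
  exact prod_withDensity_right (measurable_similarityDensity hg hr P).ennreal_ofReal

theorem IsExact.ae_refMeasure (hA : A.IsExact ν fg fr k) (hg : IsDensity ν fg)
    (hr : IsDensity ν fr) : ∀ᵐ x ∂(A.refMeasure ν), ∀ P : Clustering n, P.parts.card = k →
      0 < similarityDensity fg fr P x.2 → A.Returns P x P := by
  rw [ae_all_iff]
  intro P
  by_cases hP : P.parts.card = k
  · have h := hA P hP
    rw [law_eq hg hr] at h
    filter_upwards [(ae_withDensity_ofReal_iff
      ((measurable_similarityDensity hg hr P).comp measurable_snd)).1 h] with x hx _ using hx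
  · exact ae_of_all _ fun x h => absurd h hP

/-- If the two distributions are mutually absolutely continuous, then the densities of the
similarity matrix are positive together, so the algorithm is correct for all clusterings at once. -/
theorem IsExact.isExperiment (hA : A.IsExact ν fg fr k) (hg : IsDensity ν fg)
    (hr : IsDensity ν fr) (hgr : densityLaw ν fg ≪ densityLaw ν fr)
    (hrg : densityLaw ν fr ≪ densityLaw ν fg) (hH : hellinger ν fg fr < 1) :
    IsExperiment A k (hellinger ν fg fr) (A.law ν fg fr) where
  isProbabilityMeasure P := by
    have := isProbabilityMeasure_similarityLaw hg hr P
    unfold law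
    infer_instance
  returns P := by
    have hpos : ∀ᵐ y ∂ν, 0 < fg y ↔ 0 < fr y := by
      have key : ∀ {f g : ℝ → ℝ}, IsDensity ν f → IsDensity ν g →
          densityLaw ν f ≪ densityLaw ν g → ∀ᵐ y ∂ν, 0 < f y → 0 < g y := by
        intro f g hf hg hfg
        have h : ∀ᵐ y ∂(densityLaw ν g), 0 < g y :=
          (ae_withDensity_ofReal_iff hg.measurable).2 (ae_of_all _ fun y hy => hy)
        exact (ae_withDensity_ofReal_iff hf.measurable).1 (hfg.ae_le h)
      filter_upwards [key hg hr hgr, key hr hg hrg] with y h1 h2 using ⟨h1, h2⟩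
    have hpi : ∀ᵐ w ∂(Measure.pi fun _ : Pair n => ν), ∀ p, 0 < fg (w p) ↔ 0 < fr (w p) := by
      rw [ae_all_iff]
      exact fun p => (Measure.quasiMeasurePreserving_eval (fun _ : Pair n => ν) p).ae hpos
    have hpi' : ∀ᵐ x ∂(A.refMeasure ν), ∀ p, 0 < fg (x.2 p) ↔ 0 < fr (x.2 p) :=
      Measure.quasiMeasurePreserving_snd.ae hpi
    rw [law_eq hg hr]
    refine (ae_withDensity_ofReal_iff
      ((measurable_similarityDensity hg hr P).comp measurable_snd)).2 ?_
    filter_upwards [hpi', hA.ae_refMeasure hg hr] with x hx hret hP P' hP'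
    refine hret P' hP' ?_
    have h0 : ∀ p, 0 < entryDensity fg fr P p (x.2 p) := fun p => by
      refine lt_of_le_of_ne ((isDensity_entryDensity hg hr P p).nonneg _) fun h0 =>
        (show 0 < similarityDensity fg fr P x.2 from hP).ne' ?_
      exact Finset.prod_eq_zero (Finset.mem_univ p) h0.symm
    refine Finset.prod_pos fun p _ => ?_
    have h1 := h0 p
    have h2 := hx p
    unfold entryDensity at h1 ⊢
    split_ifs at h1 ⊢ <;> tauto
  le_add P P' E hE := by
    have := isProbabilityMeasure_similarityLaw hg hr P
    have := isProbabilityMeasure_similarityLaw hg hr P'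
    rw [law, law, Measure.prod_apply hE, Measure.prod_apply hE]
    calc _ ≤ ∫⁻ y, (similarityLaw ν fg fr P' (Prod.mk y ⁻¹' E) + ENNReal.ofReal
          √(1 - ((1 - hellinger ν fg fr ^ 2) ^ (diffPairs P P').card) ^ 2)) ∂A.seedLaw :=
          lintegral_mono fun y => similarityLaw_le_add hg hr hH P P' (measurable_prodMk_left hE)
      _ = _ := by
          rw [lintegral_add_right _ measurable_const, lintegral_const, measure_univ, mul_one]

/-- A seed and matrix for which the algorithm is correct for all clusterings carry no information
on the clustering: they form an experiment with divergence `0`. -/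
theorem isExperiment_dirac {x : A.Seed × Similarity n}
    (hx : ∀ P : Clustering n, P.parts.card = k → A.Returns P x P) :
    IsExperiment A k 0 fun _ => Measure.dirac x where
  isProbabilityMeasure _ := inferInstance
  returns P := by
    rw [ae_dirac_iff]
    · exact hx
    · simp only [Set.ofPred_forall]
      exact .iInter fun P' => .iInter fun _ => measurableSet_returns A P' P'
  le_add _ _ _ _ := le_self_add

theorem IsExact.exists_pos_law (hA : A.IsExact ν fg fr k) (hg : IsDensity ν fg)
    (hr : IsDensity ν fr) (hH0 : 0 < hellinger ν fg fr) (hH : hellinger ν fg fr < 1) (hk : 2 ≤ k)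
    (hkn : k < n) : ∃ P : Clustering n, P.parts.card = k ∧
      0 < A.law ν fg fr P {x | ENNReal.ofReal (1 / 24576 * queryBound n k (hellinger ν fg fr)) ≤
        ((A.numQueries P x : ℕ∞) : ℝ≥0∞)} := by
  set B := ENNReal.ofReal (1 / 24576 * queryBound n k (hellinger ν fg fr)) with hB
  -- with positive probability, all entries of the matrix are possible for both densities
  let S : Set ℝ := {y | 0 < fg y ∧ 0 < fr y}
  have hS : ν S ≠ 0 := by
    intro h0
    have h1 : ∫ y, √(fg y * fr y) ∂ν = 0 := by
      refine integral_eq_zero_of_ae ?_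
      have h2 : ∀ᵐ y ∂ν, y ∉ S := measure_eq_zero_iff_ae_notMem.1 h0
      filter_upwards [h2] with y hy
      rw [Pi.zero_apply, Real.sqrt_eq_zero']
      simp only [S, Set.mem_ofPred_eq, not_and, not_lt] at hy
      rcases (hg.nonneg y).eq_or_lt with h3 | h3
      · rw [← h3, zero_mul]
      · exact mul_nonpos_of_nonneg_of_nonpos h3.le (hy h3)
    rw [integral_sqrt_mul hg hr] at h1
    nlinarith
  let T : Set (A.Seed × Similarity n) := Set.univ ×ˢ Set.univ.pi fun _ => S
  have hT : A.refMeasure ν T ≠ 0 := by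
    rw [refMeasure, Measure.prod_prod, Measure.pi_pi, measure_univ, one_mul]
    exact Finset.prod_ne_zero_iff.2 fun _ _ => hS
  have hTpos : ∀ x ∈ T, ∀ P : Clustering n, 0 < similarityDensity fg fr P x.2 := by
    intro x hx P
    refine Finset.prod_pos fun p _ => ?_
    have h1 := hx.2 p trivial
    unfold entryDensity
    split_ifs
    exacts [h1.1, h1.2]
  have hlarge : ∀ᵐ x ∂(A.refMeasure ν), x ∈ T → ∃ P : Clustering n, P.parts.card = k ∧
      B ≤ ((A.numQueries P x : ℕ∞) : ℝ≥0∞) := by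
    filter_upwards [hA.ae_refMeasure hg hr] with x hx hxT
    have hQ := isExperiment_dirac fun P hP => hx P hP (hTpos x hxT P)
    obtain ⟨P, hP, hle⟩ := hQ.exists_bound_le hk hkn (η := 0)
      (L := 1 / hellinger ν fg fr ^ 2) le_rfl le_rfl one_pos (by positivity) (by norm_num)
    refine ⟨P, hP, ?_⟩
    rw [lintegral_dirac' _ (measurable_numQueries A P)] at hle
    refine le_trans (le_of_eq ?_) hle
    rw [hB, queryBound, ← div_eq_mul_one_div]
    norm_num
  by_contra! hno
  have hzero : ∀ P : Clustering n, P.parts.card = k → ∀ᵐ x ∂(A.refMeasure ν), x ∈ T →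
      ¬ B ≤ ((A.numQueries P x : ℕ∞) : ℝ≥0∞) := by
    intro P hP
    have h1 := measure_eq_zero_iff_ae_notMem.1 (le_antisymm (hno P hP) zero_le)
    rw [law_eq hg hr] at h1
    filter_upwards [(ae_withDensity_ofReal_iff
      ((measurable_similarityDensity hg hr P).comp measurable_snd)).1 h1] with x hx hxT
    exact hx (hTpos x hxT P)
  have hall : ∀ᵐ x ∂(A.refMeasure ν), ∀ P : Clustering n, P.parts.card = k → x ∈ T →
      ¬ B ≤ ((A.numQueries P x : ℕ∞) : ℝ≥0∞) := by
    rw [ae_all_iff]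
    intro P
    by_cases hP : P.parts.card = k
    · filter_upwards [hzero P hP] with x hx _ using hx
    · exact ae_of_all _ fun x h => absurd h hP
  refine hT (measure_eq_zero_iff_ae_notMem.2 ?_)
  filter_upwards [hlarge, hall] with x h1 h2 hxT
  obtain ⟨P, hP, hle⟩ := h1 hxT
  exact h2 P hP hxT hle

end RandAlg

theorem corollary1 :
    -- with a universal constant: the number of queries of an exact algorithm
    (∃ c : ℝ, 0 < c ∧
      ∀ (n k : ℕ), 2 ≤ k → k < n →
      ∀ (ν : Measure ℝ) [SigmaFinite ν] (fg fr : ℝ → ℝ), IsDensity ν fg → IsDensity ν fr →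
      0 < hellinger ν fg fr → hellinger ν fg fr < 1 →
      ∀ A : RandAlg.{u} n, A.IsExact ν fg fr k →
      ∃ P : Clustering n, P.parts.card = k ∧
        0 < A.law ν fg fr P
          {x | ENNReal.ofReal (c * queryBound n k (hellinger ν fg fr)) ≤
            ((A.numQueries P x : ℕ∞) : ℝ≥0∞)}) ∧
    -- the expected number of queries, if the two distributions are mutually absolutely continuous
    (∀ η : ℝ, η < 1 → ∃ c : ℝ, 0 < c ∧
      ∀ (n k : ℕ), 2 ≤ k → k < n →
      ∀ (ν : Measure ℝ) [SigmaFinite ν] (fg fr : ℝ → ℝ), IsDensity ν fg → IsDensity ν fr →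
      densityLaw ν fg ≪ densityLaw ν fr → densityLaw ν fr ≪ densityLaw ν fg →
      0 < hellinger ν fg fr → hellinger ν fg fr ≤ η →
      ∀ A : RandAlg.{u} n, A.IsExact ν fg fr k →
      ∃ P : Clustering n, P.parts.card = k ∧
        ENNReal.ofReal (c * queryBound n k (hellinger ν fg fr)) ≤
          ∫⁻ x, ((A.numQueries P x : ℕ∞) : ℝ≥0∞) ∂(A.law ν fg fr P)) := by
  refine ⟨⟨1 / 24576, by norm_num, ?_⟩, fun η hη1 => ?_⟩
  · intro n k hk hkn ν _ fg fr hg hr hH0 hH A hA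
    exact hA.exists_pos_law hg hr hH0 hH hk hkn
  rcases lt_or_ge η 0 with hη0 | hη0
  · -- no divergence is negative
    refine ⟨1, one_pos, ?_⟩
    intro n k hk hkn ν _ fg fr hg hr hgr hrg hH0 hH
    linarith
  refine ⟨(1 - √(1 - (1 - η ^ 2) ^ 2)) ^ 2 / 24576, ?_, ?_⟩
  · have h1 : 0 < (1 - η ^ 2) ^ 2 := pow_pos (by nlinarith) 2
    have h2 : √(1 - (1 - η ^ 2) ^ 2) < 1 := (Real.sqrt_lt' one_pos).2 (by linarith)
    have h3 : 0 < 1 - √(1 - (1 - η ^ 2) ^ 2) := by linarith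
    positivity
  intro n k hk hkn ν _ fg fr hg hr hgr hrg hH0 hH A hA
  obtain ⟨P, hP, hle⟩ := (hA.isExperiment hg hr hgr hrg (hH.trans_lt hη1)).exists_bound_le hk hkn
    hH0.le hH hη1 (L := 1 / hellinger ν fg fr ^ 2) (by positivity)
    (by rw [one_div_mul_cancel (by positivity)])
  refine ⟨P, hP, ?_⟩
  rwa [← div_eq_mul_one_div] at hle
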